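/- **Theorem (Strict FFR, edge user).** Let the base stations form a homogeneous Poisson point process of intensity $\lambda>0$ in $\mathbb{R}^2$, all transmitting with power $P>0$; let $\alpha>2$ be the path-loss exponent, $\sigma^2\ge 0$ the noise power and $\Delta\ge 1$ an integer. A user at a fixed location is served by its nearest base station $y$; write $R_z$ for the distance from the user to base station $z$ and $r=R_y$. Independently of the base station positions, the base stations $z$ carry i.i.d. marks $(g_z,\hat g_z,\delta_z)$ with independent components, where $g_z$ and $\hat g_z$ are exponentially distributed with rate $\mu>0$ (mean $1/\mu$; Rayleigh fading on the common band and on the edge sub-band), and $\delta_z$ is uniformly distributed on the $\Delta$ edge sub-bands. On the common band all other base stations interfere; on the edge sub-band those with the sub-band of the serving one interfere: \[ \mathrm{SINR}=\frac{P g_y r^{-\alpha}}{\sigma^2+P\sum_{z\ne y} g_z R_z^{-\alpha}},\qquad \widehat{\mathrm{SINR}}=\frac{P \hat g_y r^{-\alpha}}{\sigma^2+P\sum_{z\ne y,\ \delta_z=\delta_y} \hat g_z R_z^{-\alpha}} . \] Let $T,T_{FR}>0$. Both interference sums are almost surely finite, $\mathbb{P}(\mathrm{SINR}<T_{FR})>0$,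 and the coverage probability of an edge user (a user with $\mathrm{SINR}<T_{FR}$, who is moved to the edge sub-band $\delta_y$) is \[ \mathbb{P}\bigl(\widehat{\mathrm{SINR}}>T \,\big|\, \mathrm{SINR}<T_{FR}\bigr) =\frac{p_c(T,\lambda,\alpha,\Delta)-\pi\lambda\int_0^\infty e^{-\pi\lambda v(1+2\xi(T,T_{FR},\alpha,\Delta))-\mu(T+T_{FR})\frac{\sigma^2}{P}v^{\alpha/2}}\,dv}{1-p_c(T_{FR},\lambda,\alpha,1)}, \] where all integrals converge, $p_c(T_{FR},\lambda,\alpha,1)<1$, and \[ p_c(T,\lambda,\alpha,\Delta)=\pi\lambda\int_0^\infty e^{-\pi\lambda v\left(1+\frac1\Delta\rho(T,\alpha)\right)-\mu T\frac{\sigma^2}{P}v^{\alpha/2}}\,dv,\qquad \rho(T,\alpha)=T^{2/\alpha}\int_{T^{-2/\alpha}}^\infty\frac{du}{1+u^{\alpha/2}}, \] \[ \xi(T,T_{FR},\alpha,\Delta)=\int_1^\infty\left[1-\frac{1}{1+T_{FR}x^{-\alpha}}\left(1-\frac1\Delta\left(1-\frac{1}{1+Tx^{-\alpha}}\right)\right)\right]x\,dx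 . \] -/

import Mathlib

open MeasureTheory ProbabilityTheory Set

noncomputable section

namespace StrictFFR

/-! ### Poisson point processes -/

/-- The number of points of the (enumerated) point process `X` that lie in the set `A`. -/
def count {Ω E : Type*} (X : ℕ → Ω → E) (A : Set E) (ω : Ω) : ℕ∞ :=
  Set.encard {n : ℕ | X n ω ∈ A}

/-- The random points `X 0, X 1, …`, in an arbitrary order, form a Poisson point process with
intensity measure `ν`: the number of points in a measurable set of finite intensity is Poisson
distributed with mean the intensity of the set, and the numbers of points in pairwise disjoint
measurable sets are independent. -/
structure IsPoissonProcess {Ω E : Type*} [MeasurableSpace Ω] [MeasurableSpace E]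
    (Pr : Measure Ω) (X : ℕ → Ω → E) (ν : Measure E) : Prop where
  measurable : ∀ n, Measurable (X n)
  count_law : ∀ A : Set E, MeasurableSet A → ν A ≠ ⊤ →
    HasLaw (count X A) ((poissonMeasure (ν A).toNNReal).map (fun k : ℕ => (k : ℕ∞))) Pr
  count_indep : ∀ (m : ℕ) (A : Fin m → Set E), (∀ i, MeasurableSet (A i)) →
    Pairwise (fun i j => Disjoint (A i) (A j)) → iIndepFun (fun i => count X (A i)) Pr

/-! ### The network -/

/-- The plane. -/
abbrev Plane : Type := EuclideanSpace ℝ (Fin 2)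

/-- The random data of the network. Base station `n` sits at `X n`; `g n` and `gHat n` are the
fading powers between base station `n` and the user on the common band and on the edge sub-band;
`δ n` is the edge sub-band, one of `Δ`, used by base station `n`. The base stations form a
homogeneous Poisson process of intensity `lam`, and, independently of their positions, they carry
i.i.d. marks `(g n, gHat n, δ n)` with independent components: two exponential variables of rate
`μ` (Rayleigh fading) and a uniform sub-band. -/
structure IsNetwork {Ω : Type*} [MeasurableSpace Ω] (Pr : Measure Ω) (lam μ : ℝ) (Δ : ℕ)
    (X : ℕ → Ω → Plane) (g gHat : ℕ → Ω → ℝ) (δ : ℕ → Ω → Fin Δ) : Prop where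
  poisson : IsPoissonProcess Pr X (ENNReal.ofReal lam • (volume : Measure Plane))
  measurable_g : ∀ n, Measurable (g n)
  measurable_gHat : ∀ n, Measurable (gHat n)
  measurable_δ : ∀ n, Measurable (δ n)
  law_g : ∀ n, Pr.map (g n) = expMeasure μ
  law_gHat : ∀ n, Pr.map (gHat n) = expMeasure μ
  law_δ : ∀ n (k : Fin Δ), Pr {ω | δ n ω = k} = (Δ : ENNReal)⁻¹
  indep_fading : ∀ n, IndepFun (g n) (gHat n) Pr
  indep_band : ∀ n, IndepFun (fun ω => (g n ω, gHat n ω)) (δ n) Pr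
  indep_marks : iIndepFun (fun n ω => (g n ω, gHat n ω, δ n ω)) Pr
  indep_position : IndepFun (fun ω n => X n ω) (fun ω n => (g n ω, gHat n ω, δ n ω)) Pr

/-- The index of the base station serving a user at `u`: the nearest one (a tie is resolved by
the smallest index; almost surely there is none). -/
def serving {Ω : Type*} (X : ℕ → Ω → Plane) (u : Plane) (ω : Ω) : ℕ :=
  sInf {n : ℕ | ∀ k, dist (X n ω) u ≤ dist (X k ω) u}

/-- The power, relative to the transmit power, that a user at `u` receives from base station `n`
under the fading powers `h` and the path loss exponent `α`. -/
def gain {Ω : Type*} (X : ℕ → Ω → Plane) (h : ℕ → Ω → ℝ) (u : Plane) (α : ℝ) (ω : Ω)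
    (n : ℕ) : ℝ :=
  h n ω * dist (X n ω) u ^ (-α)

/-- The base stations that interfere on the common band: all but the serving one. -/
def commonInterferers {Ω : Type*} (X : ℕ → Ω → Plane) (u : Plane) (ω : Ω) : Set ℕ :=
  {n | n ≠ serving X u ω}

/-- The base stations that interfere on the edge sub-band of the user: all those, but the serving
one, that use the same edge sub-band as the serving one. -/
def edgeInterferers {Ω : Type*} {Δ : ℕ} (X : ℕ → Ω → Plane) (δ : ℕ → Ω → Fin Δ) (u : Plane)
    (ω : Ω) : Set ℕ :=
  {n | n ≠ serving X u ω ∧ δ n ω = δ (serving X u ω) ω}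

/-- The signal to interference plus noise ratio of a user at `u` for the fading powers `h`, the
set of interferers `Z`, the transmit power `P` and the noise power `σ2`. -/
def sinr {Ω : Type*} (X : ℕ → Ω → Plane) (h : ℕ → Ω → ℝ) (Z : Ω → Set ℕ) (u : Plane)
    (α P σ2 : ℝ) (ω : Ω) : ℝ :=
  P * gain X h u α ω (serving X u ω) / (σ2 + P * ∑' z : Z ω, gain X h u α ω z)

/-! ### The explicit expressions -/

/-- The integrand of `rho`. -/
def rhoIntegrand (α u : ℝ) : ℝ := 1 / (1 + u ^ (α / 2))

/-- The function `ρ(T, α)`. -/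
def rho (T α : ℝ) : ℝ :=
  T ^ (2 / α) * ∫ u in Ioi (T ^ (-2 / α)), rhoIntegrand α u

/-- The integrand of `pc`. -/
def pcIntegrand (lam μ α P σ2 : ℝ) (Δ : ℕ) (T v : ℝ) : ℝ :=
  Real.exp (-Real.pi * lam * v * (1 + 1 / (Δ : ℝ) * rho T α)
    - μ * T * (σ2 / P) * v ^ (α / 2))

/-- The reuse-`Δ` coverage probability expression `p_c(T, λ, α, Δ)`. -/
def pc (lam μ α P σ2 : ℝ) (Δ : ℕ) (T : ℝ) : ℝ :=
  Real.pi * lam * ∫ v in Ioi (0 : ℝ), pcIntegrand lam μ α P σ2 Δ T v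

/-- The integrand of `xi`. -/
def xiIntegrand (T TFR α : ℝ) (Δ : ℕ) (x : ℝ) : ℝ :=
  (1 - 1 / (1 + TFR * x ^ (-α)) *
    (1 - 1 / (Δ : ℝ) * (1 - 1 / (1 + T * x ^ (-α))))) * x

/-- The function `ξ(T, T_FR, α, Δ)`. -/
def xi (T TFR α : ℝ) (Δ : ℕ) : ℝ :=
  ∫ x in Ioi (1 : ℝ), xiIntegrand T TFR α Δ x

/-- The integrand of the term that couples the two bands. -/
def jointIntegrand (lam μ α P σ2 : ℝ) (Δ : ℕ) (T TFR v : ℝ) : ℝ :=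
  Real.exp (-Real.pi * lam * v * (1 + 2 * xi T TFR α Δ)
    - μ * (T + TFR) * (σ2 / P) * v ^ (α / 2))

end StrictFFR

end

/-! Everything reduces to one quantity, the probability that the edge SINR exceeds `t` and the
common SINR is at least `t'`, for thresholds `t, t' ≥ 0` (`measure_joint_coverage`). If `A` is the
edge-user event and `B` is coverage on the edge sub-band, then `P(B ∩ A) = P(B) - P(B \ A)`, and
`P(B)`, `P(Aᶜ)`, `P(B \ A)` are the joint probabilities at `(T, 0)`, `(0, TFR)`, `(T, TFR)`: a zero
threshold is almost surely no condition.

Fix the positions. After division by the path gain of the serving station, each event says that an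
exponential variable exceeds the threshold times noise plus interference, with relative gains `w n =
(R n / r) ^ (-α)`. Exponential tails and independence of the marks turn this into `exp(-μ (t + t')
(σ2 / P) r ^ α)` times the product of `markTransform Δ t t' (w n)` over the other stations
(`measure_coverage`). The two bands share the positions, so this product does not split into
separate averages.

Now average over positions. A disc of radius `√s` has area `π s`, so the squared distances form a
homogeneous Poisson process of rate `π λ` on the half-line (`map_dist_sq_volume`). Its minimum `v`
is exponential, and the points above `v` remain Poisson. Their Laplace functional, rescaled by `v`,
is `exp(-π λ v · 2ξ)`, with `2ξ` the integral of `1 - markTransform` at `x ^ (-α/2)` over `x > 1`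
(`two_mul_xi`). Integrating against the law of `v` gives the formula.

Conditioning on the null event `v = x` is avoided. The minimum is rounded up to a mesh, where the
independence of counts gives an exact identity (`lintegral_meshAbove`), and the mesh is refined
(`lintegral_expNeg_min`). Only the laws and the independence of counts are assumed, so the Laplace
functional is built up from simple functions (`lintegral_expNeg_tsum`). Using `e⁻ˣ` on `[0, ∞]`
makes all sums meaningful, and the value `∞` encodes excluded configurations. -/

namespace StrictFFR

open Filter Topology
open scoped ENNReal NNReal

/-! ### The function `x ↦ e⁻ˣ` on `[0, ∞]` -/

/-- The function `x ↦ e⁻ˣ` on `[0, ∞]`. -/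
noncomputable def expNeg (x : ℝ≥0∞) : ℝ≥0∞ := EReal.exp (-(x : EReal))

@[simp] lemma expNeg_zero : expNeg 0 = 1 := by simp [expNeg]

@[simp] lemma expNeg_top : expNeg ⊤ = 0 := by simp [expNeg]

lemma expNeg_add (x y : ℝ≥0∞) : expNeg (x + y) = expNeg x * expNeg y := by
  rw [expNeg, EReal.coe_ennreal_add, EReal.neg_add, sub_eq_add_neg, EReal.exp_add]
  · rfl
  · exact Or.inl (by simp)
  · exact Or.inr (by simp)

lemma continuous_expNeg : Continuous expNeg :=
  ENNReal.continuous_exp.comp (continuous_neg.comp continuous_coe_ennreal_ereal)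

@[fun_prop] lemma measurable_expNeg : Measurable expNeg := continuous_expNeg.measurable

lemma antitone_expNeg : Antitone expNeg := fun _ _ h =>
  EReal.exp_monotone (EReal.neg_le_neg_iff.2 (EReal.coe_ennreal_le_coe_ennreal_iff.2 h))

lemma expNeg_le_one (x : ℝ≥0∞) : expNeg x ≤ 1 := by
  simpa using antitone_expNeg (zero_le (a := x))

lemma expNeg_ne_top (x : ℝ≥0∞) : expNeg x ≠ ⊤ :=
  ((expNeg_le_one x).trans_lt ENNReal.one_lt_top).ne

lemma expNeg_ofReal {x : ℝ} (hx : 0 ≤ x) : expNeg (ENNReal.ofReal x) = ENNReal.ofReal (Real.exp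
    (-x)) := by
  rw [expNeg, EReal.coe_ennreal_ofReal, max_eq_left hx, ← EReal.coe_neg, EReal.exp_coe]

lemma expNeg_of_ne_top {x : ℝ≥0∞} (hx : x ≠ ⊤) :
    expNeg x = ENNReal.ofReal (Real.exp (-x.toReal)) := by
  rw [← expNeg_ofReal ENNReal.toReal_nonneg, ENNReal.ofReal_toReal hx]

lemma expNeg_mul_natCast (x : ℝ≥0∞) (k : ℕ) : expNeg (x * k) = expNeg x ^ k := by
  induction k with
  | zero => simp
  | succ k ih => rw [Nat.cast_succ, mul_add, mul_one, expNeg_add, ih, pow_succ]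

lemma expNeg_sum {ι : Type*} (s : Finset ι) (f : ι → ℝ≥0∞) :
    expNeg (∑ i ∈ s, f i) = ∏ i ∈ s, expNeg (f i) := by
  classical
  induction s using Finset.induction_on with
  | empty => simp
  | insert i s hi ih => rw [Finset.sum_insert hi, Finset.prod_insert hi, expNeg_add, ih]

lemma one_sub_expNeg_le (x : ℝ≥0∞) : 1 - expNeg x ≤ x := by
  rcases eq_or_ne x ⊤ with rfl | hx
  · simp
  · rw [expNeg_of_ne_top hx, ← ENNReal.ofReal_one, ← ENNReal.ofReal_sub _ (Real.exp_nonneg _)]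
    refine (ENNReal.ofReal_le_ofReal ?_).trans (ENNReal.ofReal_toReal hx).le
    linarith [Real.add_one_le_exp (-x.toReal)]

/-! ### The Laplace functional of a Poisson process -/

/-- With `q = e⁻ᶜ` this is the exponential series in `r q`. The value `c = ∞` is included, with `q =
0`, and gives the void probability. -/
lemma lintegral_expNeg_poissonMeasure (c : ℝ≥0∞) (r : ℝ≥0) :
    ∫⁻ k : ℕ, expNeg (c * k) ∂(poissonMeasure r) = expNeg (r * (1 - expNeg c)) := by
  obtain ⟨q, hq⟩ : ∃ q : ℝ≥0, expNeg c = q := ⟨_, (ENNReal.coe_toNNReal (expNeg_ne_top c)).symm⟩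
  have hq1 : q ≤ 1 := by exact_mod_cast hq ▸ expNeg_le_one c
  have h := ((NormedSpace.expSeries_div_hasSum_exp ((r : ℝ) * q)).mul_left (Real.exp (-r)))
  rw [← Real.exp_eq_exp_ℝ, ← Real.exp_add] at h
  have e : ((r : ℝ≥0∞) * (1 - (q : ℝ≥0∞))) = ENNReal.ofReal (r * (1 - q)) := by
    rw [ENNReal.ofReal_mul r.coe_nonneg, ENNReal.ofReal_sub _ q.coe_nonneg]
    simp
  rw [poissonMeasure, lintegral_sum_measure]
  simp_rw [lintegral_smul_measure, lintegral_dirac, expNeg_mul_natCast, hq, smul_eq_mul, e]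
  rw [expNeg_ofReal (mul_nonneg r.coe_nonneg (sub_nonneg.2 (by exact_mod_cast hq1)))]
  have e2 : ∀ n : ℕ, ENNReal.ofReal (Real.exp (-r) * r ^ n / (n.factorial)) * (q : ℝ≥0∞) ^ n =
      ENNReal.ofReal (Real.exp (-r) * (((r : ℝ) * q) ^ n / (n.factorial))) := by
    intro n
    have : (q : ℝ≥0∞) ^ n = ENNReal.ofReal ((q : ℝ) ^ n) := by
      rw [ENNReal.ofReal_pow q.coe_nonneg]; simp
    rw [this, ← ENNReal.ofReal_mul (by positivity)]
    congr 1; ring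
  simp_rw [e2]
  rw [← ENNReal.ofReal_tsum_of_nonneg (fun n => by positivity) h.summable, h.tsum_eq]
  congr 2; ring

section PointProcess

variable {Ω E : Type*} [MeasurableSpace Ω] [MeasurableSpace E] {Pr : Measure Ω} {X : ℕ → Ω → E}
  {ν : Measure E}

lemma measurable_count (hX : ∀ n, Measurable (X n)) {A : Set E} (hA : MeasurableSet A) :
    Measurable (count X A) :=
  measurable_encard.comp (measurable_set_iff.2 fun n => measurable_mem.2 (hX n hA))

/-- The counting measure of a realisation of a point process. -/
noncomputable def pointMeasure {Ω E : Type*} [MeasurableSpace E] (X : ℕ → Ω → E) (ω : Ω) : Measure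
    E :=
  Measure.sum fun n => Measure.dirac (X n ω)

omit [MeasurableSpace Ω] in
lemma lintegral_pointMeasure (X : ℕ → Ω → E) (ω : Ω) {F : E → ℝ≥0∞} (hF : Measurable F) :
    ∫⁻ x, F x ∂(pointMeasure X ω) = ∑' n, F (X n ω) := by
  simp_rw [pointMeasure, lintegral_sum_measure, lintegral_dirac' _ hF]

omit [MeasurableSpace Ω] in
lemma pointMeasure_apply (X : ℕ → Ω → E) (ω : Ω) {A : Set E} (hA : MeasurableSet A) :
    pointMeasure X ω A = (count X A ω : ℝ≥0∞) := by
  rw [pointMeasure, Measure.sum_apply _ hA, count, ← ENNReal.tsum_set_one,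
      tsum_subtype _ (fun _ => (1 : ℝ≥0∞))]
  congr 1; ext n
  simp [Measure.dirac_apply' _ hA, indicator]

namespace IsPoissonProcess

variable (h : IsPoissonProcess Pr X ν)
include h

/-- Infinite intensity is allowed when `c = 0`, where both sides are 1: the zero fibre of a simple
function usually has infinite intensity. -/
lemma lintegral_expNeg_count (c : ℝ≥0∞) {A : Set E} (hA : MeasurableSet A)
    [IsProbabilityMeasure Pr] (hc : c ≠ 0 → ν A ≠ ⊤) :
    ∫⁻ ω, expNeg (c * count X A ω) ∂Pr = expNeg ((1 - expNeg c) * ν A) := by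
  rcases eq_or_ne c 0 with rfl | h0
  · simp
  · have hl := h.count_law A hA (hc h0)
    have := hl.lintegral_comp (f := fun k : ℕ∞ => expNeg (c * k)) (by fun_prop)
    rw [this, lintegral_map (by fun_prop) (by fun_prop)]
    simp only [ENat.toENNReal_coe]
    rw [lintegral_expNeg_poissonMeasure, ENNReal.coe_toNNReal (hc h0), mul_comm]

/-- The sum over the points is a finite combination of counts in the fibres, which are disjoint, so
the exponential factorises. -/
lemma lintegral_expNeg_simpleFunc [IsProbabilityMeasure Pr] (f : SimpleFunc E ℝ≥0∞)
    (hf : ∀ c ≠ 0, ν (f ⁻¹' {c}) ≠ ⊤) :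
    ∫⁻ ω, expNeg (∑' n, f (X n ω)) ∂Pr = expNeg (∫⁻ x, 1 - expNeg (f x) ∂ν) := by
  have e1 : ∀ ω, ∑' n, f (X n ω) = ∑ c ∈ f.range, c * count X (f ⁻¹' {c}) ω := by
    intro ω
    rw [← lintegral_pointMeasure X ω f.measurable, SimpleFunc.lintegral_eq_lintegral,
      SimpleFunc.lintegral]
    simp_rw [pointMeasure_apply X ω (f.measurableSet_fiber _)]
  have e2 : ∫⁻ x, 1 - expNeg (f x) ∂ν = ∑ c ∈ f.range, (1 - expNeg c) * ν (f ⁻¹' {c}) := by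
    rw [← SimpleFunc.map_lintegral, ← SimpleFunc.lintegral_eq_lintegral]
    rfl
  simp_rw [e1, e2, expNeg_sum]
  -- Independence of counts is assumed for families indexed by `Fin m`, so the values of `f` are
  -- enumerated.
  let e := f.range.equivFin
  have hind := h.count_indep _ (fun i => f ⁻¹' {(e.symm i : ℝ≥0∞)})
    (fun i => f.measurableSet_fiber _) (fun i j hij => by
      refine Disjoint.preimage _ (disjoint_singleton.2 fun heq => hij ?_)
      exact e.symm.injective (Subtype.ext heq))
  have hind2 := hind.comp (fun i (k : ℕ∞) => expNeg ((e.symm i : ℝ≥0∞) * k)) (fun i => by fun_prop)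
  have hm : ∀ i, Measurable ((fun (k : ℕ∞) => expNeg ((e.symm i : ℝ≥0∞) * k)) ∘
      count X (f ⁻¹' {(e.symm i : ℝ≥0∞)})) := fun i =>
    (by fun_prop : Measurable fun (k : ℕ∞) => expNeg ((e.symm i : ℝ≥0∞) * k)).comp
      (measurable_count h.measurable (f.measurableSet_fiber _))
  have key := lintegral_prod_eq_prod_lintegral_of_indepFun Finset.univ _ hind2 hm
  have tr : ∀ φ : ℝ≥0∞ → ℝ≥0∞, ∏ c ∈ f.range, φ c = ∏ i, φ (e.symm i) := by
    intro φ
    rw [← Finset.prod_coe_sort, Equiv.prod_comp e.symm (fun c => φ c)]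
  simp_rw [tr]
  simp only [Function.comp_apply] at key
  rw [key]
  exact Finset.prod_congr rfl fun i _ =>
    h.lintegral_expNeg_count _ (f.measurableSet_fiber _) (fun hc => hf _ hc)

/-- The Laplace functional of a Poisson process. -/
lemma lintegral_expNeg_tsum [IsProbabilityMeasure Pr] [SigmaFinite ν] {F : E → ℝ≥0∞}
    (hF : Measurable F) :
    ∫⁻ ω, expNeg (∑' n, F (X n ω)) ∂Pr = expNeg (∫⁻ x, 1 - expNeg (F x) ∂ν) := by
  -- Restricting to sets of finite intensity gives every nonzero value a fibre of finite intensity.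
  let f : ℕ → SimpleFunc E ℝ≥0∞ := fun k => (SimpleFunc.eapprox F k).restrict (spanningSets ν k)
  have hfa : ∀ k x, f k x = (spanningSets ν k).indicator (SimpleFunc.eapprox F k) x := fun k x =>
    SimpleFunc.restrict_apply _ (measurableSet_spanningSets ν k) x
  have hmono : Monotone fun k x => f k x := by
    intro k l hkl x
    simp only [hfa]
    refine (indicator_le_indicator_of_subset (monotone_spanningSets ν hkl) (fun _ => zero_le)
        x).trans
      (indicator_le_indicator (SimpleFunc.monotone_eapprox F hkl x))
  have hlim : ∀ x, Tendsto (fun k => f k x) atTop (𝓝 (F x)) := by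
    intro x
    refine (SimpleFunc.tendsto_eapprox hF x).congr' ?_
    filter_upwards [eventually_ge_atTop (spanningSetsIndex ν x)] with k hk
    rw [hfa, indicator_of_mem]
    exact mem_spanningSets_of_index_le ν x hk
  have hfin : ∀ k, ∀ c ≠ 0, ν (f k ⁻¹' {c}) ≠ ⊤ := by
    intro k c hc
    refine ((measure_mono ?_).trans_lt (measure_spanningSets_lt_top ν k)).ne
    intro x hx
    by_contra hx'
    rw [mem_preimage, mem_singleton_iff, hfa, indicator_of_notMem hx'] at hx
    exact hc hx.symm
  have hX := h.measurable
  have l1 : Tendsto (fun k => ∫⁻ ω, expNeg (∑' n, f k (X n ω)) ∂Pr) atTop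
      (𝓝 (∫⁻ ω, expNeg (∑' n, F (X n ω)) ∂Pr)) := by
    refine tendsto_lintegral_of_dominated_convergence (fun _ => 1) (fun k => ?_) (fun k => ?_)
      (by simp) (ae_of_all _ fun ω => ?_)
    · exact measurable_expNeg.comp (Measurable.tsum fun n => (f k).measurable.comp (hX n))
    · exact ae_of_all _ fun ω => expNeg_le_one _
    · refine (continuous_expNeg.tendsto _).comp ?_
      simp_rw [← lintegral_pointMeasure X ω hF, ← lintegral_pointMeasure X ω (f _).measurable]
      exact lintegral_tendsto_of_tendsto_of_monotone (fun k => (f k).measurable.aemeasurable)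
        (ae_of_all _ fun x => fun k l hkl => hmono hkl x) (ae_of_all _ hlim)
  have l2 : Tendsto (fun k => expNeg (∫⁻ x, 1 - expNeg (f k x) ∂ν)) atTop
      (𝓝 (expNeg (∫⁻ x, 1 - expNeg (F x) ∂ν))) := by
    refine (continuous_expNeg.tendsto _).comp ?_
    refine lintegral_tendsto_of_tendsto_of_monotone
      (fun k => (measurable_const.sub (measurable_expNeg.comp (f k).measurable)).aemeasurable)
      (ae_of_all _ fun x => fun k l hkl => tsub_le_tsub_left (antitone_expNeg (hmono hkl x)) 1)
      (ae_of_all _ fun x => ?_)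
    exact ENNReal.Tendsto.sub tendsto_const_nhds ((continuous_expNeg.tendsto _).comp (hlim x))
      (Or.inl ENNReal.one_ne_top)
  refine tendsto_nhds_unique l1 (l2.congr fun k => ?_)
  rw [h.lintegral_expNeg_simpleFunc (f k) (hfin k)]

/-- The Laplace functional of `F / k` is at least `exp(-∫F / k)`, and it is at most the probability
of a finite sum because `e^{-∞} = 0`. Then `k → ∞`. -/
lemma ae_tsum_ne_top [IsProbabilityMeasure Pr] [SigmaFinite ν] {F : E → ℝ≥0∞}
    (hF : Measurable F) (hint : ∫⁻ x, F x ∂ν ≠ ⊤) : ∀ᵐ ω ∂Pr, ∑' n, F (X n ω) ≠ ⊤ := by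
  have hm : Measurable fun ω => ∑' n, F (X n ω) :=
    Measurable.tsum fun n => hF.comp (h.measurable n)
  have hms : MeasurableSet {ω | ∑' n, F (X n ω) ≠ ⊤} := hm (measurableSet_singleton ⊤).compl
  have bound : ∀ k : ℕ, expNeg ((k : ℝ≥0∞)⁻¹ * ∫⁻ x, F x ∂ν) ≤ Pr {ω | ∑' n, F (X n ω) ≠ ⊤} := by
    intro k
    calc expNeg ((k : ℝ≥0∞)⁻¹ * ∫⁻ x, F x ∂ν)
        = expNeg (∫⁻ x, (k : ℝ≥0∞)⁻¹ * F x ∂ν) := by rw [lintegral_const_mul _ hF]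
      _ ≤ expNeg (∫⁻ x, 1 - expNeg ((k : ℝ≥0∞)⁻¹ * F x) ∂ν) :=
          antitone_expNeg (lintegral_mono fun x => one_sub_expNeg_le _)
      _ = ∫⁻ ω, expNeg (∑' n, (k : ℝ≥0∞)⁻¹ * F (X n ω)) ∂Pr :=
          (h.lintegral_expNeg_tsum (hF.const_mul _)).symm
      _ ≤ ∫⁻ ω, {ω | ∑' n, F (X n ω) ≠ ⊤}.indicator (fun _ => 1) ω ∂Pr := by
          refine lintegral_mono fun ω => ?_
          rw [ENNReal.tsum_mul_left]
          by_cases hω : ∑' n, F (X n ω) = ⊤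
          · simp [hω, ENNReal.mul_top]
          · rw [indicator_of_mem (by exact hω)]
            exact expNeg_le_one _
      _ = _ := lintegral_indicator_one hms
  have hl : Tendsto (fun k : ℕ => expNeg ((k : ℝ≥0∞)⁻¹ * ∫⁻ x, F x ∂ν)) atTop (𝓝 1) := by
    rw [← expNeg_zero]
    refine (continuous_expNeg.tendsto _).comp ?_
    simpa using ENNReal.Tendsto.mul_const ENNReal.tendsto_inv_nat_nhds_zero (Or.inr hint)
  have := le_of_tendsto' hl bound
  exact (prob_compl_eq_zero_iff hms).2 (le_antisymm prob_le_one this)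

/-- From `e⁻ʳ ≥ 1 - r` one gets `1 - e⁻ʳ(1 + r) ≤ r²`. The quadratic order is what rules out
coincident points. -/
lemma measure_two_le_count [IsProbabilityMeasure Pr] {A : Set E} (hA : MeasurableSet A)
    (hν : ν A ≠ ⊤) : Pr {ω | 2 ≤ count X A ω} ≤ ν A ^ 2 := by
  obtain ⟨r, hr⟩ : ∃ r : ℝ≥0, ν A = r := ⟨_, (ENNReal.coe_toNNReal hν).symm⟩
  have hl := h.count_law A hA hν
  have e := hl.measure_eq (p := fun k => 2 ≤ k) (MeasurableSet.of_discrete)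
  rw [e, Measure.map_apply (by fun_prop) MeasurableSet.of_discrete, hr, ENNReal.toNNReal_coe]
  have : (fun k : ℕ => (k : ℕ∞)) ⁻¹' {x | 2 ≤ x} = {0, 1}ᶜ := by
    ext k
    simp only [mem_preimage, mem_ofPred_eq, Nat.ofNat_le_cast, mem_compl_iff, mem_insert_iff,
        mem_singleton_iff]
    omega
  rw [this, prob_compl_eq_one_sub (MeasurableSet.of_discrete)]
  have hp : poissonMeasure r {0, 1} = ENNReal.ofReal (Real.exp (-r) * (1 + r)) := by
    rw [insert_eq, measure_union (by simp) (by simp), poissonMeasure_singleton,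
      poissonMeasure_singleton, ← ENNReal.ofReal_add (by positivity) (by positivity)]
    congr 1; simp; ring
  rw [hp, ← ENNReal.ofReal_one, ← ENNReal.ofReal_sub _ (by positivity),
    ← ENNReal.ofReal_coe_nnreal, ← ENNReal.ofReal_pow r.coe_nonneg]
  refine ENNReal.ofReal_le_ofReal ?_
  nlinarith [Real.one_sub_le_exp_neg (r : ℝ), r.coe_nonneg]

lemma map {E' : Type*} [MeasurableSpace E'] {φ : E → E'} (hφ : Measurable φ) :
    IsPoissonProcess Pr (fun n ω => φ (X n ω)) (ν.map φ) where
  measurable n := hφ.comp (h.measurable n)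
  count_law A hA hν := by
    rw [Measure.map_apply hφ hA] at hν ⊢
    exact h.count_law _ (hφ hA) hν
  count_indep m A hA hd :=
    h.count_indep m (fun i => φ ⁻¹' A i) (fun i => hφ (hA i)) fun i j hij => (hd hij).preimage φ

end IsPoissonProcess
end PointProcess

/-! ### Poisson processes on the half-line -/

/-- The intensity measure `κ dx` on the positive half-line. -/
noncomputable def halfLine (κ : ℝ) : Measure ℝ := Real.toNNReal κ • volume.restrict (Ioi 0)

instance (κ : ℝ) : IsLocallyFiniteMeasure (halfLine κ) := by unfold halfLine; infer_instance

lemma halfLine_eq (κ : ℝ) : halfLine κ = ENNReal.ofReal κ • volume.restrict (Ioi 0) := rfl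

lemma halfLine_Iio (κ : ℝ) (t : ℝ) : halfLine κ (Iio t) = ENNReal.ofReal κ * ENNReal.ofReal t := by
  rw [halfLine_eq, Measure.smul_apply, Measure.restrict_apply measurableSet_Iio, Iio_inter_Ioi,
    Real.volume_Ioo, sub_zero, smul_eq_mul]

lemma halfLine_Ico_le (κ : ℝ) (s t : ℝ) :
    halfLine κ (Ico s t) ≤ ENNReal.ofReal κ * ENNReal.ofReal (t - s) := by
  rw [halfLine_eq, Measure.smul_apply, smul_eq_mul, ← Real.volume_Ico]
  exact mul_le_mul' le_rfl (Measure.restrict_apply_le _ _)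

/-- A disc of radius `√t` has area `π t`, linear in `t`; agreement on the half-lines `Iio t`, of
finite mass, passes to the intervals `Ico` and determines the measure. -/
lemma map_dist_sq_volume (κ : ℝ) (u : Plane) :
    (ENNReal.ofReal κ • (volume : Measure Plane)).map (fun x => dist x u ^ 2) =
      halfLine (Real.pi * κ) := by
  have hm : Measurable fun x : Plane => dist x u ^ 2 := by fun_prop
  have hI : ∀ t, (ENNReal.ofReal κ • (volume : Measure Plane)).map (fun x => dist x u ^ 2) (Iio t) =
      halfLine (Real.pi * κ) (Iio t) := by
    intro t
    rw [halfLine_Iio, Measure.map_apply hm measurableSet_Iio, Measure.smul_apply]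
    rcases le_or_gt t 0 with ht | ht
    · have : (fun x : Plane => dist x u ^ 2) ⁻¹' Iio t = ∅ := by
        ext x
        simpa using ht.trans (sq_nonneg _)
      simp [this, ENNReal.ofReal_of_nonpos ht]
    · have : (fun x : Plane => dist x u ^ 2) ⁻¹' Iio t = Metric.ball u (Real.sqrt t) := by
        ext x
        simp [Real.lt_sqrt dist_nonneg]
      rw [this, EuclideanSpace.volume_ball_fin_two, ← ENNReal.ofReal_pow (Real.sqrt_nonneg _),
        Real.sq_sqrt ht.le, ENNReal.ofReal_mul Real.pi_nonneg, smul_eq_mul]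
      ring
  refine (Measure.ext_of_Ico _ _ fun a b hab => ?_).symm
  have hfin : halfLine (Real.pi * κ) (Iio a) ≠ ⊤ := by
    rw [halfLine_Iio]; exact ENNReal.mul_ne_top (by simp) (by simp)
  rw [← Iio_sdiff_Iio, measure_sdiff (Iio_subset_Iio hab.le) measurableSet_Iio.nullMeasurableSet
      hfin,
    measure_sdiff (Iio_subset_Iio hab.le) measurableSet_Iio.nullMeasurableSet ((hI a).trans_ne
        hfin), hI, hI]

section
variable {Ω : Type*} [MeasurableSpace Ω] {Pr : Measure Ω} [IsProbabilityMeasure Pr]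
  {V : ℕ → Ω → ℝ} {κ : ℝ}

/-- `count` counts indices, so two coincident points below `K` put count at least 2 in one of the `K
N` cells of length `1 / N`. This has probability at most `K N (κ / N)² = K κ² / N`, which tends to
0. -/
lemma IsPoissonProcess.ae_injective (h : IsPoissonProcess Pr V (halfLine κ))
    (h0 : ∀ n ω, 0 ≤ V n ω) : ∀ᵐ ω ∂Pr, Function.Injective fun n => V n ω := by
  have hK : ∀ K : ℕ, ∀ᵐ ω ∂Pr, ∀ n m, V n ω = V m ω → V n ω < K → n = m := by
    intro K
    rw [ae_iff]
    have bound : ∀ N : ℕ, 0 < N → Pr {ω | ¬ ∀ n m, V n ω = V m ω → V n ω < K → n = m} ≤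
        ENNReal.ofReal (K * κ ^ 2 / N) := by
      intro N hN
      have hN' : (0 : ℝ) < N := by exact_mod_cast hN
      calc Pr {ω | ¬ ∀ n m, V n ω = V m ω → V n ω < K → n = m}
          ≤ Pr (⋃ k ∈ Finset.range (K * N),
              {ω | 2 ≤ count V (Ico ((k : ℝ) / N) ((k + 1 : ℕ) / N)) ω}) := by
            refine measure_mono fun ω hω => ?_
            simp only [mem_ofPred_eq, not_forall] at hω
            obtain ⟨n, m, hnm, hlt, hne⟩ := hω
            simp only [mem_iUnion, mem_ofPred_eq, Finset.mem_range]
            have hfl : (⌊V n ω * N⌋₊ : ℝ) ≤ V n ω * N :=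
              Nat.floor_le (mul_nonneg (h0 n ω) hN'.le)
            have hfl2 := Nat.lt_floor_add_one (V n ω * N)
            have hmem : V n ω ∈ Ico ((⌊V n ω * N⌋₊ : ℝ) / N) ((⌊V n ω * N⌋₊ + 1 : ℕ) / N) :=
              ⟨(div_le_iff₀ hN').2 hfl, (lt_div_iff₀ hN').2 (by push_cast; exact hfl2)⟩
            refine ⟨⌊V n ω * N⌋₊, ?_, ?_⟩
            · rw [Nat.floor_lt (mul_nonneg (h0 n ω) hN'.le)]
              push_cast
              exact mul_lt_mul_of_pos_right hlt hN'
            · have : 1 < count V (Ico ((⌊V n ω * N⌋₊ : ℝ) / N) ((⌊V n ω * N⌋₊ + 1 : ℕ) / N)) ω :=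
                one_lt_encard_iff.2 ⟨n, m, hmem, by rw [mem_ofPred_eq, ← hnm]; exact hmem, hne⟩
              exact Order.add_one_le_of_lt this
        _ ≤ ∑ k ∈ Finset.range (K * N),
              Pr {ω | 2 ≤ count V (Ico ((k : ℝ) / N) ((k + 1 : ℕ) / N)) ω} :=
            measure_biUnion_finset_le _ _
        _ ≤ ∑ k ∈ Finset.range (K * N), (ENNReal.ofReal κ * ENNReal.ofReal (1 / N)) ^ 2 := by
            refine Finset.sum_le_sum fun k _ => ?_
            have hle := halfLine_Ico_le κ ((k : ℝ) / N) ((k + 1 : ℕ) / N)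
            have : ((k + 1 : ℕ) : ℝ) / N - k / N = 1 / N := by push_cast; ring
            rw [this] at hle
            refine (h.measure_two_le_count measurableSet_Ico
              (hle.trans_lt (ENNReal.mul_lt_top (by simp) (by simp))).ne).trans ?_
            gcongr
        _ ≤ ENNReal.ofReal (K * κ ^ 2 / N) := by
            rw [Finset.sum_const, Finset.card_range, nsmul_eq_mul, mul_pow,
                ← ENNReal.ofReal_pow (by positivity : (0 : ℝ) ≤ 1 / N),
              ← ENNReal.ofReal_natCast]
            have : ENNReal.ofReal κ ^ 2 ≤ ENNReal.ofReal (κ ^ 2) := by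
              rcases le_total 0 κ with hκ | hκ
              · rw [ENNReal.ofReal_pow hκ]
              · simp [ENNReal.ofReal_of_nonpos hκ]
            refine (mul_le_mul' le_rfl (mul_le_mul' this le_rfl)).trans ?_
            rw [← ENNReal.ofReal_mul (by positivity), ← ENNReal.ofReal_mul (by positivity)]
            refine ENNReal.ofReal_le_ofReal (le_of_eq ?_)
            push_cast; field_simp
    refine le_antisymm (ge_of_tendsto (x := atTop)
      (f := fun N : ℕ => ENNReal.ofReal (K * κ ^ 2 / N)) ?_ ?_) zero_le
    · rw [← ENNReal.ofReal_zero]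
      exact (ENNReal.continuous_ofReal.tendsto _).comp (tendsto_const_div_atTop_nhds_zero_nat _)
    · filter_upwards [eventually_gt_atTop 0] with N hN using bound N hN
  filter_upwards [ae_all_iff.2 hK] with ω hω n m hnm
  obtain ⟨K, hK⟩ := exists_nat_gt (V n ω)
  exact hω K n m hnm hK

end

/-! ### Exponential laws: tails and density -/

lemma expMeasure_absolutelyContinuous (r : ℝ) : expMeasure r ≪ volume :=
  withDensity_absolutelyContinuous _ _

instance (r : ℝ) : NullSingletonClass (expMeasure r) :=
  ⟨fun x => expMeasure_absolutelyContinuous r (measure_singleton x)⟩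

lemma expMeasure_Ioi {r : ℝ} (hr : 0 < r) {b : ℝ} (hb : 0 ≤ b) :
    expMeasure r (Ioi b) = expNeg (ENNReal.ofReal (r * b)) := by
  have := isProbabilityMeasure_expMeasure hr
  have h := cdf_expMeasure_eq hr b
  rw [if_pos hb, cdf_eq_real] at h
  have h2 : (expMeasure r).real (Ioi b) = Real.exp (-(r * b)) := by
    rw [← compl_Iic, probReal_compl_eq_one_sub measurableSet_Iic, h]; ring
  rw [expNeg_ofReal (by positivity), ← h2, ofReal_measureReal]

lemma expMeasure_Ici {r : ℝ} (hr : 0 < r) {b : ℝ} (hb : 0 ≤ b) :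
    expMeasure r (Ici b) = expNeg (ENNReal.ofReal (r * b)) := by
  rw [← expMeasure_Ioi hr hb]
  exact (measure_congr Ioi_ae_eq_Ici).symm

lemma expMeasure_Iic_zero {r : ℝ} (hr : 0 < r) : expMeasure r (Iic 0) = 0 := by
  have := isProbabilityMeasure_expMeasure hr
  rw [← compl_Ioi, prob_compl_eq_zero_iff measurableSet_Ioi, expMeasure_Ioi hr le_rfl]
  simp

lemma lintegral_expMeasure {r : ℝ} (hr : 0 < r) {F : ℝ → ℝ≥0∞} (hF : Measurable F) :
    ∫⁻ x, F x ∂(expMeasure r) = ∫⁻ x in Ioi 0, ENNReal.ofReal (r * Real.exp (-(r * x))) * F x := by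
  have hm : ∀ᵐ x ∂(expMeasure r), x ∈ Ioi 0 := by
    rw [ae_iff]
    exact (congrArg _ (by ext; simp)).trans (expMeasure_Iic_zero hr)
  rw [← Measure.restrict_eq_self_of_ae_mem hm]
  change ∫⁻ x, F x ∂((volume.withDensity (gammaPDF 1 r)).restrict (Ioi 0)) = _
  rw [restrict_withDensity measurableSet_Ioi, lintegral_withDensity_eq_lintegral_mul _
    (show Measurable (gammaPDF 1 r) from (measurable_gammaPDFReal 1 r).ennreal_ofReal) hF]
  refine setLIntegral_congr_fun measurableSet_Ioi fun x hx => ?_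
  exact congrArg (· * F x) (exponentialPDF_of_nonneg (le_of_lt hx))

/-! ### Summability of negative powers and existence of a strict minimum -/

section
variable {Ω : Type*} [MeasurableSpace Ω] {Pr : Measure Ω} [IsProbabilityMeasure Pr]
  {V : ℕ → Ω → ℝ} {κ a : ℝ}

/-- The test function `F` is `∞` on the nonpositive reals, which carry no intensity, so a finite sum
forces positivity. Elsewhere it is `v ^ (-a)` capped at 1, which is integrable near 0 and, as `a >
1`, at infinity. -/
lemma IsPoissonProcess.ae_summable_rpow (h : IsPoissonProcess Pr V (halfLine κ)) (ha : 1 < a) :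
    ∀ᵐ ω ∂Pr, (∀ n, 0 < V n ω) ∧ Summable fun n => V n ω ^ (-a) := by
  let F : ℝ → ℝ≥0∞ := fun v => if v ≤ 0 then ⊤ else ENNReal.ofReal (min 1 (v ^ (-a)))
  have hF : Measurable F := Measurable.ite measurableSet_Iic measurable_const (by fun_prop)
  have hint : ∫⁻ x, F x ∂(halfLine κ) ≠ ⊤ := by
    rw [halfLine_eq, lintegral_smul_measure, smul_eq_mul]
    refine ENNReal.mul_ne_top ENNReal.ofReal_ne_top (ne_of_lt ?_)
    calc ∫⁻ x in Ioi 0, F x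
        = ∫⁻ x in Ioc 0 1 ∪ Ioi 1, F x := by rw [Ioc_union_Ioi_eq_Ioi zero_le_one]
      _ ≤ (∫⁻ x in Ioc 0 1, F x) + ∫⁻ x in Ioi 1, F x := lintegral_union_le _ _ _
      _ ≤ (∫⁻ x in Ioc (0 : ℝ) 1, 1) + ∫⁻ x in Ioi 1, ENNReal.ofReal (x ^ (-a)) := by
          refine add_le_add (setLIntegral_mono' measurableSet_Ioc fun x hx => ?_)
            (setLIntegral_mono' measurableSet_Ioi fun x hx => ?_)
          · simp only [F, if_neg (not_le.2 hx.1)]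
            rw [← ENNReal.ofReal_one]
            exact ENNReal.ofReal_le_ofReal (min_le_left _ _)
          · simp only [F, if_neg (not_le.2 (zero_lt_one.trans (mem_Ioi.1 hx)))]
            exact ENNReal.ofReal_le_ofReal (min_le_right _ _)
      _ < ⊤ := by
          refine ENNReal.add_lt_top.2 ⟨by simp, ?_⟩
          exact ((integrableOn_Ioi_rpow_of_lt (by linarith) zero_lt_one).lintegral_lt_top)
  filter_upwards [h.ae_tsum_ne_top hF hint] with ω hω
  have hpos : ∀ n, 0 < V n ω := by
    intro n
    by_contra hn
    exact ENNReal.ne_top_of_tsum_ne_top hω n (if_pos (not_lt.1 hn))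
  refine ⟨hpos, ?_⟩
  have e : ∀ n, F (V n ω) = ENNReal.ofReal (min 1 (V n ω ^ (-a))) := fun n => if_neg (not_le.2
      (hpos n))
  simp_rw [e] at hω
  have hs : Summable fun n => min 1 (V n ω ^ (-a)) := by
    have := ENNReal.summable_toReal hω
    refine this.congr fun n => ENNReal.toReal_ofReal (le_min zero_le_one (Real.rpow_nonneg (hpos
        n).le _))
  -- The terms tend to 0, so the cap is inactive from some index on.
  have ht := hs.tendsto_atTop_zero
  refine hs.congr_atTop ?_
  filter_upwards [ht.eventually (gt_mem_nhds one_pos)] with n hn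
  rcases min_lt_iff.1 hn with h1 | h1
  · exact absurd h1 (lt_irrefl _)
  · exact min_eq_right h1.le

end

/-- A sequence of distinct positive reals whose negative powers are summable has a strict
minimum. -/
lemma exists_forall_ne_lt {v : ℕ → ℝ} {a : ℝ} (ha : 0 < a) (hpos : ∀ n, 0 < v n)
    (hs : Summable fun n => v n ^ (-a)) (hinj : Function.Injective v) :
    ∃ y, ∀ n ≠ y, v y < v n := by
  have hfin : {n | v n ≤ v 0}.Finite := by
    have := hs.tendsto_cofinite_zero.eventually (gt_mem_nhds (Real.rpow_pos_of_pos (hpos 0) (-a)))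
    refine this.subset fun n hn => ?_
    simp only [mem_compl_iff, mem_ofPred_eq, not_lt] at hn ⊢
    exact Real.rpow_le_rpow_of_nonpos (hpos n) hn (by linarith)
  obtain ⟨y, hy, hmin⟩ := exists_min_image _ v hfin ⟨0, le_refl (v 0)⟩
  refine ⟨y, fun n hn => ?_⟩
  rcases le_or_gt (v n) (v 0) with h | h
  · exact lt_of_le_of_ne (hmin n h) fun e => hn (hinj e).symm
  · exact lt_of_le_of_lt hy h

lemma lintegral_Ici_div {F : ℝ → ℝ≥0∞} (hF : Measurable F) {s : ℝ} (hs : 0 < s) :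
    ∫⁻ x in Ici s, F (x / s) = ENNReal.ofReal s * ∫⁻ x in Ioi 1, F x := by
  rw [← lintegral_indicator measurableSet_Ici]
  have e : ∀ x, (Ici s).indicator (fun x => F (x / s)) x = (Ici 1).indicator F (s⁻¹ * x) := by
    intro x
    have : x ∈ Ici s ↔ s⁻¹ * x ∈ Ici 1 := by
      rw [mem_Ici, mem_Ici, inv_mul_eq_div, le_div_iff₀ hs, one_mul]
    by_cases hx : x ∈ Ici s
    · rw [indicator_of_mem hx, indicator_of_mem (this.1 hx), inv_mul_eq_div]
    · rw [indicator_of_notMem hx, indicator_of_notMem (fun h => hx (this.2 h))]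
  simp_rw [e]
  rw [← lintegral_map (hF.indicator measurableSet_Ici) (measurable_const_mul s⁻¹),
    Real.map_volume_mul_left (inv_ne_zero hs.ne'), lintegral_smul_measure, inv_inv, abs_of_pos hs,
    lintegral_indicator measurableSet_Ici, smul_eq_mul, restrict_Ioi_eq_restrict_Ici]

/-! ### Joint law of the minimum and of the points above it -/

section
variable {Ω : Type*} [MeasurableSpace Ω] {Pr : Measure Ω} [IsProbabilityMeasure Pr]
  {V : ℕ → Ω → ℝ} {κ a : ℝ} {v : Ω → ℝ}

/-- The joint law of the minimum `v` of a Poisson process and of a scaled Laplace functional of its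
points above a level `s`, on the event that the minimum is at least `t`. -/
lemma IsPoissonProcess.lintegral_indicator_expNeg (h : IsPoissonProcess Pr V (halfLine κ))
    (hv : ∀ᵐ ω ∂Pr, ∃ y, v ω = V y ω ∧ ∀ n ≠ y, v ω < V n ω) {f : ℝ → ℝ}
    (hf : Measurable f) {c : ℝ}
    (hc : ∫⁻ x in Ioi 1, (1 - expNeg (ENNReal.ofReal (f x))) = ENNReal.ofReal c)
    {t s : ℝ} (hts : t ≤ s) (hs : 0 < s) :
    ∫⁻ ω, {ω | t ≤ v ω}.indicator 1 ω *
        expNeg (∑' n, if s ≤ V n ω then ENNReal.ofReal (f (V n ω / s)) else 0) ∂Pr =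
      expNeg (ENNReal.ofReal κ * ENNReal.ofReal t) *
        expNeg (ENNReal.ofReal κ * ENNReal.ofReal s * ENNReal.ofReal c) := by
  -- The value `∞` below `t` makes the exponential vanish unless all points are at least `t`, so the
  -- indicator is absorbed into one Laplace functional.
  let F : ℝ → ℝ≥0∞ := fun x => if x < t then ⊤ else if s ≤ x then ENNReal.ofReal (f (x / s)) else 0
  have hF : Measurable F := Measurable.ite measurableSet_Iio measurable_const
    (Measurable.ite measurableSet_Ici (by fun_prop) measurable_const)
  have e1 : ∫⁻ ω, {ω | t ≤ v ω}.indicator 1 ω *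
        expNeg (∑' n, if s ≤ V n ω then ENNReal.ofReal (f (V n ω / s)) else 0) ∂Pr =
      ∫⁻ ω, expNeg (∑' n, F (V n ω)) ∂Pr := by
    refine lintegral_congr_ae ?_
    filter_upwards [hv] with ω ⟨y, hy, hmin⟩
    by_cases ht : t ≤ v ω
    · rw [indicator_of_mem (by exact ht), Pi.one_apply, one_mul]
      congr 2; ext n
      have : t ≤ V n ω := by
        rcases eq_or_ne n y with rfl | hn
        · exact hy ▸ ht
        · exact ht.trans (hmin n hn).le
      simp [F, not_lt.2 this]
    · rw [indicator_of_notMem (by exact ht), zero_mul]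
      have : ∑' n, F (V n ω) = ⊤ :=
        ENNReal.tsum_eq_top_of_eq_top ⟨y, if_pos (hy ▸ not_le.1 ht)⟩
      rw [this, expNeg_top]
  have hG : Measurable fun x => 1 - expNeg (ENNReal.ofReal (f x)) := by fun_prop
  have e2 : ∀ x, 1 - expNeg (F x) = (Iio t).indicator 1 x +
      (Ici s).indicator (fun x => 1 - expNeg (ENNReal.ofReal (f (x / s)))) x := by
    intro x
    by_cases h1 : x < t
    · have h2 : ¬ s ≤ x := not_le.2 (h1.trans_le hts)
      simp [F, h1, h2]
    · by_cases h2 : s ≤ x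
      · simp [F, h1, h2]
      · simp [F, h1, h2]
  rw [e1, h.lintegral_expNeg_tsum hF, ← expNeg_add]
  congr 1
  simp_rw [e2]
  rw [lintegral_add_left (measurable_one.indicator measurableSet_Iio),
    lintegral_indicator_one measurableSet_Iio, halfLine_Iio,
    lintegral_indicator measurableSet_Ici, halfLine_eq, Measure.restrict_smul,
    Measure.restrict_restrict measurableSet_Ici,
    inter_eq_left.2 (Ici_subset_Ioi.2 hs), lintegral_smul_measure, lintegral_Ici_div hG hs, hc,
    smul_eq_mul, mul_assoc]

lemma IsPoissonProcess.measure_le_min (h : IsPoissonProcess Pr V (halfLine κ)) (hvm : Measurable v)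
    (hv : ∀ᵐ ω ∂Pr, ∃ y, v ω = V y ω ∧ ∀ n ≠ y, v ω < V n ω) (t : ℝ) :
    Pr {ω | t ≤ v ω} = expNeg (ENNReal.ofReal κ * ENNReal.ofReal t) := by
  -- For `f = 0` the level is irrelevant; `max t 1` is merely positive and at least `t`.
  have := h.lintegral_indicator_expNeg hv (f := fun _ => 0) measurable_const (c := 0) (by simp)
    (le_max_left t 1) (lt_max_of_lt_right one_pos)
  simp only [ENNReal.ofReal_zero, ite_self, tsum_zero, expNeg_zero, mul_one, mul_zero] at this
  rw [lintegral_indicator_one (measurableSet_le measurable_const hvm)] at this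
  exact this

lemma IsPoissonProcess.map_min (h : IsPoissonProcess Pr V (halfLine κ)) (hvm : Measurable v)
    (hv : ∀ᵐ ω ∂Pr, ∃ y, v ω = V y ω ∧ ∀ n ≠ y, v ω < V n ω) (hκ : 0 < κ) :
    Pr.map v = expMeasure κ := by
  have := isProbabilityMeasure_expMeasure hκ
  have := Measure.isProbabilityMeasure_map (μ := Pr) hvm.aemeasurable
  refine Measure.ext_of_Ici _ _ fun t => ?_
  rw [Measure.map_apply hvm measurableSet_Ici]
  refine (h.measure_le_min hvm hv t).trans ?_
  rw [← ENNReal.ofReal_mul hκ.le]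
  rcases le_total 0 t with ht | ht
  · rw [expMeasure_Ici hκ ht]
  · rw [ENNReal.ofReal_of_nonpos (mul_nonpos_of_nonneg_of_nonpos hκ.le ht), expNeg_zero]
    refine le_antisymm ?_ prob_le_one
    calc (1 : ℝ≥0∞) = expMeasure κ (Ici 0) := by rw [expMeasure_Ici hκ le_rfl]; simp
      _ ≤ _ := measure_mono (Ici_subset_Ici.2 ht)

/-- The mesh point of `ℕ / (N + 1)` just above `x`. -/
noncomputable def meshAbove (N : ℕ) (x : ℝ) : ℝ := (⌊(N + 1) * x⌋₊ + 1) / (N + 1)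

lemma measurable_meshAbove (N : ℕ) : Measurable (meshAbove N) := by
  unfold meshAbove; fun_prop

lemma lt_meshAbove (N : ℕ) (x : ℝ) : x < meshAbove N x := by
  rw [meshAbove, lt_div_iff₀ (by positivity), mul_comm]
  exact Nat.lt_floor_add_one _

lemma meshAbove_le (N : ℕ) {x : ℝ} (hx : 0 ≤ x) : meshAbove N x ≤ x + 1 / (N + 1) := by
  rw [meshAbove, add_div]
  gcongr
  rw [div_le_iff₀ (by positivity), mul_comm]
  exact Nat.floor_le (by positivity)

lemma tendsto_meshAbove {x : ℝ} (hx : 0 ≤ x) :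
    Tendsto (fun N => meshAbove N x) atTop (𝓝 x) := by
  refine tendsto_of_tendsto_of_tendsto_of_le_of_le tendsto_const_nhds ?_
    (fun N => (lt_meshAbove N x).le) (fun N => meshAbove_le N hx)
  simpa using (tendsto_one_div_add_atTop_nhds_zero_nat (𝕜 := ℝ)).const_add x

/-- While the minimum stays in one mesh cell, its rounded value is a constant `s k`. The indicator
of the cell is a difference of two events `t ≤ v`, and for both of them the functional of the points
above `s k` factors out with the same factor. -/
lemma IsPoissonProcess.lintegral_meshAbove (h : IsPoissonProcess Pr V (halfLine κ))
    (hvm : Measurable v) (hv0 : ∀ ω, 0 ≤ v ω)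
    (hv : ∀ᵐ ω ∂Pr, ∃ y, v ω = V y ω ∧ ∀ n ≠ y, v ω < V n ω) {f : ℝ → ℝ}
    (hf : Measurable f) {c : ℝ}
    (hc : ∫⁻ x in Ioi 1, (1 - expNeg (ENNReal.ofReal (f x))) = ENNReal.ofReal c)
    {H : ℝ → ℝ≥0∞} (N : ℕ) :
    ∫⁻ ω, H (meshAbove N (v ω)) * expNeg (∑' n, if meshAbove N (v ω) ≤ V n ω then
        ENNReal.ofReal (f (V n ω / meshAbove N (v ω))) else 0) ∂Pr =
      ∫⁻ ω, H (meshAbove N (v ω)) *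
        expNeg (ENNReal.ofReal κ * ENNReal.ofReal (meshAbove N (v ω)) * ENNReal.ofReal c) ∂Pr := by
  have hN : (0 : ℝ) < N + 1 := by positivity
  let s : ℕ → ℝ := fun k => (k + 1) / (N + 1)
  let B : ℕ → Set Ω := fun k => {ω | ⌊(N + 1) * v ω⌋₊ = k}
  have hB : ∀ k, MeasurableSet (B k) := fun k =>
    (Nat.measurable_floor.comp (hvm.const_mul _)) (measurableSet_singleton k)
  have hV := h.measurable
  let G : ℝ → Ω → ℝ≥0∞ := fun s ω => expNeg (∑' n, if s ≤ V n ω then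
        ENNReal.ofReal (f (V n ω / s)) else 0)
  have hG : ∀ s, Measurable (G s) := fun s => measurable_expNeg.comp (Measurable.tsum fun n =>
    Measurable.ite (hV n measurableSet_Ici) (by fun_prop) measurable_const)
  have decomp : ∀ Φ : ℝ → Ω → ℝ≥0∞, (∀ s, Measurable (Φ s)) →
      ∫⁻ ω, H (meshAbove N (v ω)) * Φ (meshAbove N (v ω)) ω ∂Pr =
        ∑' k, H (s k) * ∫⁻ ω, (B k).indicator 1 ω * Φ (s k) ω ∂Pr := by
    intro Φ hΦ
    have hm : ∀ k, Measurable fun ω => (B k).indicator 1 ω * Φ (s k) ω := fun k =>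
      (measurable_one.indicator (hB k)).mul (hΦ _)
    simp_rw [← lintegral_const_mul _ (hm _)]
    rw [← lintegral_tsum fun k => ((hm k).const_mul _).aemeasurable]
    refine lintegral_congr fun ω => ?_
    rw [tsum_eq_single ⌊(N + 1) * v ω⌋₊]
    · rw [indicator_of_mem (by rfl), Pi.one_apply, one_mul]
      rfl
    · intro k hk
      rw [indicator_of_notMem (s := B k) (fun hmem => hk (Eq.symm hmem)), zero_mul, mul_zero]
  rw [decomp G hG, decomp (fun s _ => expNeg (ENNReal.ofReal κ * ENNReal.ofReal s * ENNReal.ofReal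
      c))
    fun s => measurable_const]
  refine tsum_congr fun k => congrArg _ ?_
  have hs : 0 < s k := by positivity
  have hts : (k : ℝ) / (N + 1) ≤ s k := by
    simp only [s]; gcongr; linarith
  -- Written as a sum, since truncated subtraction in `[0, ∞]` is awkward; the common term is finite
  -- and is cancelled at the end.
  have hsplit : ∀ ω, {ω | (k : ℝ) / (N + 1) ≤ v ω}.indicator (1 : Ω → ℝ≥0∞) ω =
      (B k).indicator 1 ω + {ω | s k ≤ v ω}.indicator 1 ω := by
    intro ω
    have h1 : (k : ℝ) / (N + 1) ≤ v ω ↔ k ≤ ⌊(N + 1) * v ω⌋₊ := by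
      rw [div_le_iff₀ hN, mul_comm, Nat.le_floor_iff (mul_nonneg hN.le (hv0 ω))]
    have h2 : s k ≤ v ω ↔ k + 1 ≤ ⌊(N + 1) * v ω⌋₊ := by
      rw [div_le_iff₀ hN, mul_comm, Nat.le_floor_iff (mul_nonneg hN.le (hv0 ω))]
      push_cast; rfl
    simp only [indicator, mem_ofPred_eq, h1, h2, B]
    rcases lt_trichotomy ⌊(N + 1) * v ω⌋₊ k with h3 | h3 | h3
    · simp [h3.ne, not_le.2 h3, not_le.2 (h3.trans (Nat.lt_succ_self k))]
    · simp [h3]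
    · simp [h3.ne', h3.le, Nat.succ_le_of_lt h3]
  have main : ∀ Φ : Ω → ℝ≥0∞, Measurable Φ →
      ∫⁻ ω, {ω | (k : ℝ) / (N + 1) ≤ v ω}.indicator 1 ω * Φ ω ∂Pr =
      ∫⁻ ω, (B k).indicator 1 ω * Φ ω ∂Pr + ∫⁻ ω, {ω | s k ≤ v ω}.indicator 1 ω * Φ ω ∂Pr := by
    intro Φ hΦ
    rw [← lintegral_add_left (f := fun ω => (B k).indicator 1 ω * Φ ω)
      ((measurable_one.indicator (hB k)).mul hΦ)]
    refine lintegral_congr fun ω => ?_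
    rw [hsplit, add_mul]
  have m1 := main (G (s k)) (hG _)
  rw [h.lintegral_indicator_expNeg hv hf hc hts hs, h.lintegral_indicator_expNeg hv hf hc le_rfl
      hs] at m1
  have m2 := main 1 measurable_one
  simp only [Pi.one_apply, mul_one] at m2
  rw [lintegral_indicator_one (measurableSet_le measurable_const hvm),
    lintegral_indicator_one (measurableSet_le measurable_const hvm),
    h.measure_le_min hvm hv, h.measure_le_min hvm hv] at m2
  rw [lintegral_mul_const _ (measurable_one.indicator (hB k))]
  rw [m2, add_mul] at m1
  exact ((ENNReal.add_left_inj (ENNReal.mul_ne_top (expNeg_ne_top _) (expNeg_ne_top _))).1 m1).symm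

end

/-- Continuity from the right of the scaled functional of the points above a level. -/
lemma tendsto_tsum_above {w : ℕ → ℝ} {a C : ℝ} {f : ℝ → ℝ} {v₀ : ℝ} {s : ℕ → ℝ}
    (hpos : ∀ n, 0 < w n) (ha : 0 < a) (hs : Summable fun n => w n ^ (-a)) (hv₀ : 0 < v₀)
    (hfc : ContinuousOn f (Ioi 1)) (hf0 : ∀ x, 1 ≤ x → 0 ≤ f x) (hC : 0 ≤ C)
    (hfb : ∀ x, 1 ≤ x → f x ≤ C * x ^ (-a)) (hsv : ∀ N, v₀ < s N)
    (hlim : Tendsto s atTop (𝓝 v₀)) :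
    Tendsto (fun N => ∑' n, if s N ≤ w n then ENNReal.ofReal (f (w n / s N)) else 0) atTop
      (𝓝 (∑' n, if v₀ < w n then ENNReal.ofReal (f (w n / v₀)) else 0)) := by
  -- A common bound on the levels gives the summable majorant `C * M ^ a * w n ^ (-a)`, uniform in
  -- `N`.
  obtain ⟨M, hM⟩ : ∃ M, ∀ N, s N ≤ M := hlim.bddAbove_range.imp fun M hM N => hM (mem_range_self N)
  have hM0 : 0 < M := hv₀.trans ((hsv 0).trans_le (hM 0))
  have bound : ∀ t n, 0 < t → t ≤ M → t ≤ w n → f (w n / t) ≤ C * M ^ a * w n ^ (-a) := by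
    intro t n ht htM htw
    refine (hfb _ ((one_le_div ht).2 htw)).trans ?_
    rw [Real.div_rpow (hpos n).le ht.le, Real.rpow_neg ht.le, div_inv_eq_mul, mul_assoc,
      mul_comm (M ^ a)]
    have : 0 ≤ w n ^ (-a) := Real.rpow_nonneg (hpos n).le _
    gcongr
  have g0 : ∀ t n, 0 < t → t ≤ w n → 0 ≤ f (w n / t) := fun t n ht htw =>
    hf0 _ ((one_le_div ht).2 htw)
  let r : ℕ → ℕ → ℝ := fun N n => if s N ≤ w n then f (w n / s N) else 0
  let r' : ℕ → ℝ := fun n => if v₀ < w n then f (w n / v₀) else 0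
  have hb0 : ∀ n, 0 ≤ C * M ^ a * w n ^ (-a) := fun n => by
    have := Real.rpow_nonneg (hpos n).le (-a)
    positivity
  have hr0 : ∀ N n, 0 ≤ r N n := fun N n => by
    simp only [r]; split_ifs with h
    · exact g0 _ _ (hv₀.trans (hsv N)) h
    · exact le_rfl
  have hr'0 : ∀ n, 0 ≤ r' n := fun n => by
    simp only [r']; split_ifs with h
    · exact g0 _ _ hv₀ h.le
    · exact le_rfl
  have hrb : ∀ N n, r N n ≤ C * M ^ a * w n ^ (-a) := fun N n => by
    simp only [r]; split_ifs with h
    · exact bound _ _ (hv₀.trans (hsv N)) (hM N) h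
    · exact hb0 n
  have hr'b : ∀ n, r' n ≤ C * M ^ a * w n ^ (-a) := fun n => by
    simp only [r']; split_ifs with h
    · exact bound _ _ hv₀ ((hsv 0).le.trans (hM 0)) h.le
    · exact hb0 n
  have hsum : Summable fun n => C * M ^ a * w n ^ (-a) := hs.mul_left _
  have e : ∀ N, ∑' n, (if s N ≤ w n then ENNReal.ofReal (f (w n / s N)) else 0) =
      ENNReal.ofReal (∑' n, r N n) := fun N => by
    rw [ENNReal.ofReal_tsum_of_nonneg (hr0 N) (hsum.of_nonneg_of_le (hr0 N) (hrb N))]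
    refine tsum_congr fun n => ?_
    simp only [r]; split_ifs <;> simp
  have e' : ∑' n, (if v₀ < w n then ENNReal.ofReal (f (w n / v₀)) else 0) =
      ENNReal.ofReal (∑' n, r' n) := by
    rw [ENNReal.ofReal_tsum_of_nonneg hr'0 (hsum.of_nonneg_of_le hr'0 hr'b)]
    refine tsum_congr fun n => ?_
    simp only [r']; split_ifs <;> simp
  simp_rw [e, e']
  refine (ENNReal.continuous_ofReal.tendsto _).comp ?_
  refine tendsto_tsum_of_dominated_convergence hsum (fun n => ?_)
    (Eventually.of_forall fun N n => ?_)
  · rcases lt_or_ge v₀ (w n) with h | h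
    · have hq : 1 < w n / v₀ := (one_lt_div hv₀).2 h
      have hcont : Tendsto (fun N => f (w n / s N)) atTop (𝓝 (f (w n / v₀))) :=
        (hfc.continuousAt (Ioi_mem_nhds hq)).tendsto.comp (tendsto_const_nhds.div hlim hv₀.ne')
      simp only [r', if_pos h]
      refine hcont.congr' ?_
      filter_upwards [hlim.eventually (gt_mem_nhds h)] with N hN
      simp only [r, if_pos hN.le]
    -- The levels lie strictly above `v₀`, so a point at `v₀` itself is never counted; hence the
    -- strict inequality in the limit.
    · have : ∀ N, r N n = 0 := fun N => if_neg (not_le.2 (h.trans_lt (hsv N)))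
      simp only [this, r', if_neg (not_lt.2 h)]
      exact tendsto_const_nhds
  · rw [Real.norm_of_nonneg (hr0 N n)]
    exact hrb N n

section
variable {Ω : Type*} [MeasurableSpace Ω] {Pr : Measure Ω} [IsProbabilityMeasure Pr]
  {V : ℕ → Ω → ℝ} {κ a : ℝ} {v : Ω → ℝ}

/-- The joint Laplace functional of the minimum of a homogeneous Poisson process on the half-line
and of its other points, rescaled by the minimum. -/
lemma IsPoissonProcess.lintegral_expNeg_min (h : IsPoissonProcess Pr V (halfLine κ))
    (hκ : 0 < κ) (ha : 1 < a) (hvm : Measurable v) (hv0 : ∀ ω, 0 ≤ v ω)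
    (hv : ∀ᵐ ω ∂Pr, ∃ y, v ω = V y ω ∧ ∀ n ≠ y, v ω < V n ω) {f : ℝ → ℝ}
    (hf : Measurable f) (hfc : ContinuousOn f (Ioi 1)) (hf0 : ∀ x, 1 ≤ x → 0 ≤ f x) {C : ℝ}
    (hC : 0 ≤ C) (hfb : ∀ x, 1 ≤ x → f x ≤ C * x ^ (-a)) {c : ℝ}
    (hc : ∫⁻ x in Ioi 1, (1 - expNeg (ENNReal.ofReal (f x))) = ENNReal.ofReal c)
    {H : ℝ → ℝ≥0∞} (hH : Continuous H) (hH1 : ∀ x, H x ≤ 1) :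
    ∫⁻ ω, H (v ω) *
        expNeg (∑' n, if v ω < V n ω then ENNReal.ofReal (f (V n ω / v ω)) else 0) ∂Pr =
      ∫⁻ x in Ioi 0, ENNReal.ofReal (κ * Real.exp (-(κ * x))) *
        (H x * expNeg (ENNReal.ofReal κ * ENNReal.ofReal x * ENNReal.ofReal c)) := by
  have hV := h.measurable
  let Γ : ℝ → ℝ≥0∞ := fun x =>
    H x * expNeg (ENNReal.ofReal κ * ENNReal.ofReal x * ENNReal.ofReal c)
  have hΓ : Measurable Γ := hH.measurable.mul (by fun_prop)
  have hmesh := fun N => measurable_meshAbove N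
  -- Both sides of `lintegral_meshAbove` converge, dominated by 1, as the mesh is refined.
  have l1 : Tendsto (fun N => ∫⁻ ω, H (meshAbove N (v ω)) * expNeg (∑' n,
        if meshAbove N (v ω) ≤ V n ω then
        ENNReal.ofReal (f (V n ω / meshAbove N (v ω))) else 0) ∂Pr) atTop
      (𝓝 (∫⁻ ω, H (v ω) *
        expNeg (∑' n, if v ω < V n ω then ENNReal.ofReal (f (V n ω / v ω)) else 0) ∂Pr)) := by
    refine tendsto_lintegral_of_dominated_convergence (fun _ => 1) (fun N => ?_)
      (fun N => ae_of_all _ fun ω => mul_le_one' (hH1 _) (expNeg_le_one _)) (by simp) ?_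
    · refine (hH.measurable.comp ((hmesh N).comp hvm)).mul
        (measurable_expNeg.comp (Measurable.tsum fun n => ?_))
      have hm := (hmesh N).comp hvm
      exact Measurable.ite (measurableSet_le hm (hV n))
        (ENNReal.measurable_ofReal.comp (hf.comp ((hV n).div hm))) measurable_const
    · filter_upwards [hv, h.ae_summable_rpow ha] with ω ⟨y, hy, _⟩ ⟨hpos, hsum⟩
      refine ENNReal.Tendsto.mul ((hH.tendsto _).comp (tendsto_meshAbove (hv0 ω)))
        (Or.inr (expNeg_ne_top _)) ((continuous_expNeg.tendsto _).comp ?_)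
        (Or.inr ((hH1 _).trans_lt ENNReal.one_lt_top).ne)
      exact tendsto_tsum_above hpos (by linarith) hsum (hy ▸ hpos y) hfc hf0 hC hfb
        (fun N => lt_meshAbove N _) (tendsto_meshAbove (hv0 ω))
  have l2 : Tendsto (fun N => ∫⁻ ω, H (meshAbove N (v ω)) *
        expNeg (ENNReal.ofReal κ * ENNReal.ofReal (meshAbove N (v ω)) * ENNReal.ofReal c) ∂Pr)
      atTop (𝓝 (∫⁻ ω, Γ (v ω) ∂Pr)) := by
    refine tendsto_lintegral_of_dominated_convergence (fun _ => 1) (fun N => ?_)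
      (fun N => ae_of_all _ fun ω => mul_le_one' (hH1 _) (expNeg_le_one _)) (by simp) ?_
    · exact hΓ.comp ((hmesh N).comp hvm)
    · refine ae_of_all _ fun ω => ?_
      refine ENNReal.Tendsto.mul ((hH.tendsto _).comp (tendsto_meshAbove (hv0 ω)))
        (Or.inr (expNeg_ne_top _)) ((continuous_expNeg.tendsto _).comp ?_)
        (Or.inr ((hH1 _).trans_lt ENNReal.one_lt_top).ne)
      refine ENNReal.Tendsto.mul_const (ENNReal.Tendsto.const_mul
        ((ENNReal.continuous_ofReal.tendsto _).comp (tendsto_meshAbove (hv0 ω))) (Or.inr (by simp)))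
        (Or.inr (by simp))
  have e := tendsto_nhds_unique l1 (l2.congr fun N => (h.lintegral_meshAbove hvm hv0 hv hf hc
      N).symm)
  rw [e, ← lintegral_map hΓ hvm, h.map_min hvm hv hκ, lintegral_expMeasure hκ hΓ]

end

/-! ### Laplace transform and mean of the exponential law -/

lemma lintegral_expNeg_expMeasure {r t : ℝ} (hr : 0 < r) (ht : 0 ≤ t) :
    ∫⁻ x, expNeg (ENNReal.ofReal (r * t * x)) ∂(expMeasure r) = ENNReal.ofReal (1 / (1 + t)) := by
  have hr' : 0 < r * (1 + t) := by positivity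
  have := isProbabilityMeasure_expMeasure hr'
  rw [lintegral_expMeasure hr (by fun_prop)]
  -- The tilted density is a multiple of the exponential density of rate `r (1 + t)`, whose total
  -- mass is 1.
  have h1 : ∫⁻ x in Ioi 0, ENNReal.ofReal (r * (1 + t) * Real.exp (-(r * (1 + t) * x))) = 1 := by
    have := lintegral_expMeasure hr' (F := fun _ => 1) measurable_const
    simpa using this.symm
  rw [← mul_one (ENNReal.ofReal (1 / (1 + t))), ← h1, ← lintegral_const_mul _ (by fun_prop)]
  refine setLIntegral_congr_fun measurableSet_Ioi fun x hx => ?_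
  have hx : 0 < x := hx
  rw [expNeg_ofReal (by positivity), ← ENNReal.ofReal_mul (by positivity),
      ← ENNReal.ofReal_mul (by positivity)]
  congr 1
  rw [mul_assoc r, ← Real.exp_add]
  field_simp
  congr 1; ring

lemma lintegral_id_expMeasure_ne_top {r : ℝ} (hr : 0 < r) :
    ∫⁻ x, ENNReal.ofReal x ∂(expMeasure r) ≠ ⊤ := by
  have hr' : 0 < r / 2 := by positivity
  have := isProbabilityMeasure_expMeasure hr'
  have h1 : ∫⁻ x in Ioi 0, ENNReal.ofReal (r / 2 * Real.exp (-(r / 2 * x))) = 1 := by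
    have := lintegral_expMeasure hr' (F := fun _ => 1) measurable_const
    simpa using this.symm
  rw [lintegral_expMeasure hr (by fun_prop)]
  -- Since `r x ≤ 2 e^{r x / 2}`, the integrand is at most `4 / r` times the exponential density of
  -- rate `r / 2`.
  refine ne_top_of_le_ne_top (b := ENNReal.ofReal (4 / r) * 1) (by simp) ?_
  rw [← h1, ← lintegral_const_mul _ (by fun_prop)]
  refine setLIntegral_mono' measurableSet_Ioi fun x hx => ?_
  have hx : 0 < x := hx
  rw [← ENNReal.ofReal_mul (by positivity), ← ENNReal.ofReal_mul (by positivity)]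
  refine ENNReal.ofReal_le_ofReal ?_
  have e : Real.exp (-(r / 2 * x)) = Real.exp (-(r * x)) * Real.exp (r / 2 * x) := by
    rw [← Real.exp_add]; congr 1; ring
  have h2 := Real.add_one_le_exp (r / 2 * x)
  have h3 : r * x ≤ 2 * Real.exp (r / 2 * x) := by linarith
  rw [e]
  have h4 := mul_le_mul_of_nonneg_left h3 (Real.exp_nonneg (-(r * x)))
  calc r * Real.exp (-(r * x)) * x = Real.exp (-(r * x)) * (r * x) := by ring
    _ ≤ _ := h4
    _ = _ := by field_simp; ring

/-! ### Fubini for independent variables and infinite independent families -/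

section Independence

variable {Ω E F : Type*} [MeasurableSpace Ω] [MeasurableSpace E] [MeasurableSpace F]
  {Pr : Measure Ω} [IsProbabilityMeasure Pr] {f : Ω → E} {g : Ω → F}

lemma measure_mem_of_indepFun (hf : Measurable f) (hg : Measurable g) (hfg : IndepFun f g Pr)
    {S : Set (E × F)} (hS : MeasurableSet S) :
    Pr {ω | (f ω, g ω) ∈ S} = ∫⁻ ω, Pr {ω' | (f ω, g ω') ∈ S} ∂Pr := by
  have := Measure.isProbabilityMeasure_map (μ := Pr) hg.aemeasurable
  have hlaw := (indepFun_iff_map_prod_eq_prod_map_map hf.aemeasurable hg.aemeasurable).1 hfg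
  calc Pr {ω | (f ω, g ω) ∈ S} = Pr.map (fun ω => (f ω, g ω)) S :=
        (Measure.map_apply (hf.prodMk hg) hS).symm
    _ = ∫⁻ x, Pr.map g (Prod.mk x ⁻¹' S) ∂(Pr.map f) := by rw [hlaw, Measure.prod_apply hS]
    _ = ∫⁻ ω, Pr.map g (Prod.mk (f ω) ⁻¹' S) ∂Pr :=
        lintegral_map (measurable_measure_prodMk_left hS) hf
    _ = _ := lintegral_congr fun ω => Measure.map_apply hg (measurable_prodMk_left hS)

lemma ae_mem_of_indepFun (hf : Measurable f) (hg : Measurable g) (hfg : IndepFun f g Pr)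
    {S : Set (E × F)} (hS : MeasurableSet S) (h : ∀ᵐ ω ∂Pr, ∀ᵐ ω' ∂Pr, (f ω, g ω') ∈ S) :
    ∀ᵐ ω ∂Pr, (f ω, g ω) ∈ S := by
  refine (measure_mem_of_indepFun hf hg hfg hS.compl).trans ?_
  have h0 : (fun ω => Pr {ω' | (f ω, g ω') ∈ Sᶜ}) =ᵐ[Pr] fun _ => 0 := h
  rw [lintegral_congr_ae h0, lintegral_zero]

end Independence

section
variable {Ω : Type*} [MeasurableSpace Ω] {Pr : Measure Ω}

/-- Writing each transform as `e^{-ℓ n}` turns the infinite product into a sum in `[0, ∞]`, so no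
convergence has to be checked. -/
lemma lintegral_expNeg_tsum_of_iIndepFun {Y : ℕ → Ω → ℝ≥0∞} (hY : iIndepFun Y Pr)
    (hm : ∀ n, Measurable (Y n)) {ℓ : ℕ → ℝ≥0∞}
    (hℓ : ∀ n, ∫⁻ ω, expNeg (Y n ω) ∂Pr = expNeg (ℓ n)) :
    ∫⁻ ω, expNeg (∑' n, Y n ω) ∂Pr = expNeg (∑' n, ℓ n) := by
  have := hY.isProbabilityMeasure
  have l1 : Tendsto (fun N => ∫⁻ ω, expNeg (∑ n ∈ Finset.range N, Y n ω) ∂Pr) atTop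
      (𝓝 (∫⁻ ω, expNeg (∑' n, Y n ω) ∂Pr)) := by
    refine tendsto_lintegral_of_dominated_convergence (fun _ => 1) (fun N => ?_)
      (fun N => ae_of_all _ fun ω => expNeg_le_one _) (by simp) (ae_of_all _ fun ω => ?_)
    · exact measurable_expNeg.comp (Finset.measurable_sum _ fun n _ => hm n)
    · exact (continuous_expNeg.tendsto _).comp (ENNReal.tendsto_nat_tsum _)
  have l2 : Tendsto (fun N => expNeg (∑ n ∈ Finset.range N, ℓ n)) atTop (𝓝 (expNeg (∑' n, ℓ n))) :=
    (continuous_expNeg.tendsto _).comp (ENNReal.tendsto_nat_tsum _)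
  refine tendsto_nhds_unique l1 (l2.congr fun N => ?_)
  simp_rw [expNeg_sum, ← hℓ]
  exact (lintegral_prod_eq_prod_lintegral_of_indepFun _ _
    (hY.comp (fun _ => expNeg) fun _ => measurable_expNeg) fun n => measurable_expNeg.comp (hm
        n)).symm

/-- One variable of an independent sequence is independent of all the others together. -/
lemma indepFun_remaining {E : Type*} [MeasurableSpace E] {Y : ℕ → Ω → E}
    (hY : iIndepFun Y Pr) (hm : ∀ n, Measurable (Y n)) (y : ℕ) :
    IndepFun (Y y) (fun ω (n : {n // n ≠ y}) => Y n ω) Pr := by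
  have h := indep_iSup_of_disjoint (fun n => (hm n).comap_le) hY.iIndep
    (S := {y}) (T := {y}ᶜ) disjoint_compl_right
  rw [IndepFun_iff_Indep]
  refine indep_of_indep_of_le_left (indep_of_indep_of_le_right h ?_) ?_
  · rw [MeasurableSpace.pi, MeasurableSpace.comap_iSup]
    refine iSup_le fun n => ?_
    rw [MeasurableSpace.comap_comp]
    exact le_iSup₂_of_le (f := fun i (_ : i ∈ ({y}ᶜ : Set ℕ)) => MeasurableSpace.comap (Y i) _)
      n.1 n.2 le_rfl
  · exact le_iSup₂_of_le (f := fun i (_ : i ∈ ({y} : Set ℕ)) => MeasurableSpace.comap (Y i) _)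
      y rfl le_rfl

/-- By Tonelli the sum has finite mean; independence plays no role. -/
lemma ae_summable_mul_of_exponential {h : ℕ → Ω → ℝ} (hm : ∀ n,
    Measurable (h n)) {μ : ℝ} (hμ : 0 < μ)
    (hlaw : ∀ n, Pr.map (h n) = expMeasure μ) {w : ℕ → ℝ} (hw0 : ∀ n, 0 ≤ w n) (hw : Summable w) :
    ∀ᵐ ω ∂Pr, ∑' n, ENNReal.ofReal (h n ω) * ENNReal.ofReal (w n) ≠ ⊤ := by
  have e : ∫⁻ ω, ∑' n, ENNReal.ofReal (h n ω) * ENNReal.ofReal (w n) ∂Pr ≠ ⊤ := by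
    rw [lintegral_tsum fun n => by have := hm n; fun_prop]
    have : ∀ n, ∫⁻ ω, ENNReal.ofReal (h n ω) * ENNReal.ofReal (w n) ∂Pr =
        (∫⁻ x, ENNReal.ofReal x ∂(expMeasure μ)) * ENNReal.ofReal (w n) := by
      intro n
      rw [lintegral_mul_const _ (by have := hm n; fun_prop), ← hlaw n,
        lintegral_map ENNReal.measurable_ofReal (hm n)]
    simp_rw [this]
    rw [ENNReal.tsum_mul_left, ← ENNReal.ofReal_tsum_of_nonneg hw0 hw]
    exact ENNReal.mul_ne_top (lintegral_id_expMeasure_ne_top hμ) ENNReal.ofReal_ne_top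
  have hmeas : Measurable fun ω => ∑' n, ENNReal.ofReal (h n ω) * ENNReal.ofReal (w n) :=
    Measurable.tsum fun n => by have := hm n; fun_prop
  filter_upwards [ae_lt_top hmeas e] with ω hω using hω.ne

lemma ae_forall_pos_of_exponential {h : ℕ → Ω → ℝ} (hm : ∀ n, Measurable (h n)) {μ : ℝ} (hμ : 0 < μ)
    (hlaw : ∀ n, Pr.map (h n) = expMeasure μ) : ∀ᵐ ω ∂Pr, ∀ n, 0 < h n ω := by
  refine ae_all_iff.2 fun n => ?_
  have : ∀ᵐ x ∂(Pr.map (h n)), 0 < x := by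
    rw [hlaw n, ae_iff]
    exact (congrArg _ (by ext; simp)).trans (expMeasure_Iic_zero hμ)
  exact ae_of_ae_map (hm n).aemeasurable this

end

/-! ### The marks of the base stations -/

section
variable {Ω : Type*} [MeasurableSpace Ω] {Pr : Measure Ω} [IsProbabilityMeasure Pr] {lam μ : ℝ} {Δ
    : ℕ}
  {X : ℕ → Ω → Plane} {g gHat : ℕ → Ω → ℝ} {δ : ℕ → Ω → Fin Δ}

/-- The Laplace transform of the contribution of one base station to the two interferences. -/
noncomputable def markTransform (Δ : ℕ) (T T' w : ℝ) : ℝ :=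
  1 / (1 + T' * w) * (1 - 1 / (Δ : ℝ) * (1 - 1 / (1 + T * w)))

namespace IsNetwork
variable (hnet : IsNetwork Pr lam μ Δ X g gHat δ)
include hnet

/-- By the second Borel–Cantelli lemma each sub-band is used infinitely often. So the edge
interference is not an empty sum, and the SINR denominator is positive even without noise. -/
lemma ae_exists_band : ∀ᵐ ω ∂Pr, ∀ y k, ∃ n ≠ y, δ n ω = k := by
  refine (ae_all_iff.2 fun y => ae_all_iff.2 fun k => ?_)
  have hms : ∀ n, MeasurableSet {ω | δ n ω = k} := fun n =>
    hnet.measurable_δ n (measurableSet_singleton k)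
  have hind : iIndepSet (fun n => {ω | δ n ω = k}) Pr := by
    rw [iIndepSet_iff_meas_biInter hms]
    intro s
    refine hnet.indep_marks.meas_biInter fun n _ => ⟨{m | m.2.2 = k}, ?_, rfl⟩
    exact (measurable_snd.comp measurable_snd) (measurableSet_singleton k)
  have hsum : ∑' n, Pr {ω | δ n ω = k} = ⊤ := by
    simp_rw [hnet.law_δ]
    exact ENNReal.tsum_const_eq_top_of_ne_zero (by simp)
  have := measure_limsup_eq_one hms hind hsum
  rw [← prob_compl_eq_zero_iff (MeasurableSet.measurableSet_limsup hms)] at this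
  filter_upwards [compl_mem_ae_iff.2 this] with ω hω
  rw [compl_compl, mem_limsup_iff_frequently_mem] at hω
  obtain ⟨n, hn, hk⟩ := frequently_atTop.1 hω (y + 1)
  exact ⟨n, by omega, hk⟩

omit [IsProbabilityMeasure Pr] in
lemma lintegral_mark (n : ℕ) (k : Fin Δ) {φ ψ : ℝ → ℝ≥0∞} (hφ : Measurable φ) (hψ : Measurable ψ) :
    ∫⁻ ω, φ (g n ω) * ψ (gHat n ω) * {ω | δ n ω = k}.indicator 1 ω ∂Pr =
      (∫⁻ x, φ x ∂(expMeasure μ)) * (∫⁻ x, ψ x ∂(expMeasure μ)) * (Δ : ℝ≥0∞)⁻¹ := by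
  have hg := hnet.measurable_g n
  have hh := hnet.measurable_gHat n
  have hms : MeasurableSet {ω | δ n ω = k} := hnet.measurable_δ n (measurableSet_singleton k)
  have h1 : IndepFun (fun ω => φ (g n ω) * ψ (gHat n ω)) ({ω | δ n ω = k}.indicator 1) Pr :=
    (hnet.indep_band n).comp (φ := fun p : ℝ × ℝ => φ p.1 * ψ p.2)
      (ψ := fun j => ({k} : Set (Fin Δ)).indicator (1 : Fin Δ → ℝ≥0∞) j) (by fun_prop)
      (measurable_one.indicator (measurableSet_singleton k))
  have h2 : IndepFun (fun ω => φ (g n ω)) (fun ω => ψ (gHat n ω)) Pr :=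
    (hnet.indep_fading n).comp hφ hψ
  have e1 := lintegral_mul_eq_lintegral_mul_lintegral_of_indepFun (by fun_prop)
    (measurable_one.indicator hms) h1
  have e2 := lintegral_mul_eq_lintegral_mul_lintegral_of_indepFun (by fun_prop) (by fun_prop) h2
  simp only [Pi.mul_apply] at e1 e2
  rw [e1, e2, lintegral_indicator_one hms, hnet.law_δ, ← hnet.law_g n, lintegral_map hφ hg,
    hnet.law_g n, ← hnet.law_gHat n, lintegral_map hψ hh]

omit [IsProbabilityMeasure Pr] in
-- Split according to the sub-band: the edge factor `1 / (1 + T w)` occurs with probability `1 / Δ`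
-- and is 1 otherwise, while the common factor `1 / (1 + T' w)` is always present.
lemma lintegral_expNeg_mark (hμ : 0 < μ) (hΔ : 1 ≤ Δ) (n : ℕ) (k : Fin Δ) {T T' w : ℝ} (hT : 0 ≤ T)
    (hT' : 0 ≤ T') (hw : 0 ≤ w) :
    ∫⁻ ω, expNeg (ENNReal.ofReal (μ * (T' * w) * g n ω) +
      if δ n ω = k then ENNReal.ofReal (μ * (T * w) * gHat n ω) else 0) ∂Pr =
      ENNReal.ofReal (markTransform Δ T T' w) := by
  have hg := hnet.measurable_g n
  have hh := hnet.measurable_gHat n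
  have := isProbabilityMeasure_expMeasure hμ
  have hδ : ∀ j : Fin Δ, MeasurableSet {ω | δ n ω = j} := fun j =>
    hnet.measurable_δ n (measurableSet_singleton j)
  have e : ∀ ω, expNeg (ENNReal.ofReal (μ * (T' * w) * g n ω) +
      if δ n ω = k then ENNReal.ofReal (μ * (T * w) * gHat n ω) else 0) =
      ∑ j, expNeg (ENNReal.ofReal (μ * (T' * w) * g n ω)) *
        (if j = k then expNeg (ENNReal.ofReal (μ * (T * w) * gHat n ω)) else 1) *
          {ω | δ n ω = j}.indicator 1 ω := by
    intro ω
    rw [Finset.sum_eq_single (δ n ω)]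
    · simp only [indicator, mem_ofPred_eq, if_true, Pi.one_apply, mul_one, expNeg_add]
      split_ifs <;> simp
    · intro j _ hj
      rw [indicator_of_notMem (s := {ω | δ n ω = j}) (fun h => hj (Eq.symm h)), mul_zero]
    · simp
  have hΔ0 : (0 : ℝ) < Δ := by exact_mod_cast hΔ
  simp_rw [e]
  rw [lintegral_finsetSum _ fun j _ => (by
    refine Measurable.mul (Measurable.mul (by fun_prop) ?_) (measurable_one.indicator (hδ j))
    split_ifs <;> fun_prop)]
  have e2 : ∀ j, ∫⁻ ω, expNeg (ENNReal.ofReal (μ * (T' * w) * g n ω)) *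
        (if j = k then expNeg (ENNReal.ofReal (μ * (T * w) * gHat n ω)) else 1) *
          {ω | δ n ω = j}.indicator 1 ω ∂Pr =
      ENNReal.ofReal (1 / (1 + T' * w) * (if j = k then 1 / (1 + T * w) else 1) * (1 / Δ)) := by
    intro j
    have hΔ' : (Δ : ℝ≥0∞)⁻¹ = ENNReal.ofReal (1 / Δ) := by
      rw [one_div, ENNReal.ofReal_inv_of_pos hΔ0, ENNReal.ofReal_natCast]
    rw [hnet.lintegral_mark n j (φ := fun x => expNeg (ENNReal.ofReal (μ * (T' * w) * x)))
      (ψ := fun x => if j = k then expNeg (ENNReal.ofReal (μ * (T * w) * x)) else 1) (by fun_prop)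
      (by split_ifs <;> fun_prop), lintegral_expNeg_expMeasure hμ (by positivity), hΔ',
      ENNReal.ofReal_mul (by split_ifs <;> positivity), ENNReal.ofReal_mul (by positivity)]
    congr 2
    split_ifs
    · exact lintegral_expNeg_expMeasure hμ (by positivity)
    · simp
  simp_rw [e2]
  rw [← ENNReal.ofReal_sum_of_nonneg fun j _ => by split_ifs <;> positivity]
  congr 1
  simp_rw [mul_ite, ite_mul]
  rw [Finset.sum_ite, Finset.sum_const, Finset.sum_const, Finset.filter_eq',
    if_pos (Finset.mem_univ k), Finset.card_singleton, Finset.filter_ne', 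
    Finset.card_erase_of_mem (Finset.mem_univ k), Finset.card_univ, Fintype.card_fin, markTransform,
    nsmul_eq_mul, nsmul_eq_mul, Nat.cast_sub hΔ]
  push_cast
  field_simp
  ring

end IsNetwork
end

/-! ### Exponential tails at thresholds in `[0, ∞]`, and the range of the mark transform -/

lemma expMeasure_lt_ofReal {r : ℝ} (hr : 0 < r) (A : ℝ≥0∞) :
    expMeasure r {x | A < ENNReal.ofReal x} = expNeg (ENNReal.ofReal r * A) := by
  rcases eq_or_ne A ⊤ with rfl | hA
  · simp [ENNReal.mul_top (ENNReal.ofReal_pos.2 hr).ne']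
  · have : {x | A < ENNReal.ofReal x} = Ioi A.toReal := by
      ext x; exact ENNReal.lt_ofReal_iff_toReal_lt hA
    rw [this, expMeasure_Ioi hr ENNReal.toReal_nonneg, ENNReal.ofReal_mul hr.le,
      ENNReal.ofReal_toReal hA]

lemma expMeasure_le_ofReal {r : ℝ} (hr : 0 < r) (A : ℝ≥0∞) :
    expMeasure r {x | A ≤ ENNReal.ofReal x} = expNeg (ENNReal.ofReal r * A) := by
  have := isProbabilityMeasure_expMeasure hr
  rcases eq_or_ne A ⊤ with rfl | hA
  · simp [ENNReal.mul_top (ENNReal.ofReal_pos.2 hr).ne']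
  -- At `A = 0` the set is the whole line, because `ENNReal.ofReal` sends negative reals to 0.
  · rcases eq_or_ne A 0 with rfl | h0
    · simp
    · have : {x | A ≤ ENNReal.ofReal x} = Ici A.toReal := by
        ext x
        rcases le_or_gt 0 x with hx | hx
        · exact ENNReal.le_ofReal_iff_toReal_le hA hx
        · have h1 : ¬ A ≤ ENNReal.ofReal x := by
            rw [ENNReal.ofReal_of_nonpos hx.le]; simpa using h0
          have h2 : ¬ A.toReal ≤ x := not_le.2 (hx.trans_le ENNReal.toReal_nonneg)
          exact iff_of_false h1 h2
      rw [this, expMeasure_Ici hr ENNReal.toReal_nonneg, ENNReal.ofReal_mul hr.le,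
        ENNReal.ofReal_toReal hA]

lemma markTransform_pos {Δ : ℕ} (hΔ : 1 ≤ Δ) {T T' w : ℝ} (hT : 0 ≤ T) (hT' : 0 ≤ T') (hw : 0 ≤ w) :
    0 < markTransform Δ T T' w := by
  have hΔ' : (1 : ℝ) ≤ Δ := by exact_mod_cast hΔ
  have h1 : 1 / (Δ : ℝ) ≤ 1 := by rw [div_le_one (by positivity)]; exact hΔ'
  have h2 : 0 < 1 / (1 + T * w) := by positivity
  have h3 : 1 / (1 + T * w) ≤ 1 := by
    rw [div_le_one (by positivity)]; nlinarith [mul_nonneg hT hw]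
  have h4 : 1 / (Δ : ℝ) * (1 - 1 / (1 + T * w)) ≤ 1 * (1 - 1 / (1 + T * w)) :=
    mul_le_mul_of_nonneg_right h1 (by linarith)
  refine mul_pos (by positivity) (by linarith)

lemma markTransform_le_one {Δ : ℕ} {T T' w : ℝ} (hT : 0 ≤ T) (hT' : 0 ≤ T')
    (hw : 0 ≤ w) : markTransform Δ T T' w ≤ 1 := by
  have h3 : 1 / (1 + T * w) ≤ 1 := by
    rw [div_le_one (by positivity)]; nlinarith [mul_nonneg hT hw]
  have h5 : 1 / (1 + T' * w) ≤ 1 := by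
    rw [div_le_one (by positivity)]; nlinarith [mul_nonneg hT' hw]
  have h6 : 0 ≤ 1 / (Δ : ℝ) * (1 - 1 / (1 + T * w)) := mul_nonneg (by positivity) (by linarith)
  calc markTransform Δ T T' w ≤ 1 / (1 + T' * w) * 1 :=
        mul_le_mul_of_nonneg_left (by linarith) (by positivity)
    _ ≤ 1 := by linarith

/-- The exponent of the Laplace transform of the contribution of one base station. -/
noncomputable def markExponent (Δ : ℕ) (T T' w : ℝ) : ℝ := -Real.log (markTransform Δ T T' w)

lemma expNeg_markExponent {Δ : ℕ} (hΔ : 1 ≤ Δ) {T T' w : ℝ} (hT : 0 ≤ T) (hT' : 0 ≤ T')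
    (hw : 0 ≤ w) :
    expNeg (ENNReal.ofReal (markExponent Δ T T' w)) = ENNReal.ofReal (markTransform Δ T T' w) := by
  have h := markTransform_pos hΔ hT hT' hw
  rw [markExponent, expNeg_ofReal (neg_nonneg.2 (Real.log_nonpos h.le
    (markTransform_le_one hT hT' hw))), neg_neg, Real.exp_log h]

/-- The marks of a base station: its fading powers on the two bands and its sub-band. -/
abbrev Mark (Δ : ℕ) : Type := ℝ × ℝ × Fin Δ

/-! ### Coverage on both bands for fixed positions -/

section
variable {Ω : Type*} [MeasurableSpace Ω] {Pr : Measure Ω} [IsProbabilityMeasure Pr] {lam μ : ℝ} {Δ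
    : ℕ}
  {X : ℕ → Ω → Plane} {g gHat : ℕ → Ω → ℝ} {δ : ℕ → Ω → Fin Δ}

namespace IsNetwork
variable (hnet : IsNetwork Pr lam μ Δ X g gHat δ)
include hnet

omit [IsProbabilityMeasure Pr] in
/-- The probability of coverage on both bands, given the interferences. -/
lemma measure_fading (hμ : 0 < μ) (y : ℕ) (A : Fin Δ → ℝ≥0∞) (B : ℝ≥0∞) :
    Pr {ω | A (δ y ω) < ENNReal.ofReal (gHat y ω) ∧ B ≤ ENNReal.ofReal (g y ω)} =
      ∑ k, expNeg (ENNReal.ofReal μ * B + ENNReal.ofReal μ * A k) * (Δ : ℝ≥0∞)⁻¹ := by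
  have hg := hnet.measurable_g y
  have hh := hnet.measurable_gHat y
  have hδ := hnet.measurable_δ y
  have hms : MeasurableSet
      {ω | A (δ y ω) < ENNReal.ofReal (gHat y ω) ∧ B ≤ ENNReal.ofReal (g y ω)} :=
    (measurableSet_lt ((measurable_of_finite A).comp hδ) hh.ennreal_ofReal).inter
      (measurableSet_le measurable_const hg.ennreal_ofReal)
  have hA : ∀ k, MeasurableSet {x : ℝ | A k < ENNReal.ofReal x} := fun k =>
    measurableSet_lt measurable_const (by fun_prop)
  have hB : MeasurableSet {x : ℝ | B ≤ ENNReal.ofReal x} :=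
    measurableSet_le measurable_const (by fun_prop)
  have e : ∀ ω, {ω | A (δ y ω) < ENNReal.ofReal (gHat y ω) ∧
        B ≤ ENNReal.ofReal (g y ω)}.indicator (1 : Ω → ℝ≥0∞) ω =
      ∑ k, {x | B ≤ ENNReal.ofReal x}.indicator (1 : ℝ → ℝ≥0∞) (g y ω) *
        {x | A k < ENNReal.ofReal x}.indicator (1 : ℝ → ℝ≥0∞) (gHat y ω) *
          {ω | δ y ω = k}.indicator 1 ω := by
    intro ω
    rw [Finset.sum_eq_single (δ y ω)]
    · simp only [indicator, mem_ofPred_eq, if_true, Pi.one_apply, mul_one]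
      by_cases h1 : B ≤ ENNReal.ofReal (g y ω) <;>
        by_cases h2 : A (δ y ω) < ENNReal.ofReal (gHat y ω) <;> simp [h1, h2]
    · intro j _ hj
      rw [indicator_of_notMem (s := {ω | δ y ω = j}) (fun h => hj (Eq.symm h)), mul_zero]
    · simp
  rw [← lintegral_indicator_one hms]
  simp_rw [e]
  have hm : ∀ k, Measurable fun ω => {x | B ≤ ENNReal.ofReal x}.indicator (1 : ℝ → ℝ≥0∞) (g y ω) *
        {x | A k < ENNReal.ofReal x}.indicator (1 : ℝ → ℝ≥0∞) (gHat y ω) *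
          {ω | δ y ω = k}.indicator 1 ω := fun k =>
    (((measurable_one.indicator hB).comp hg).mul ((measurable_one.indicator (hA k)).comp hh)).mul
      (measurable_one.indicator (hδ (measurableSet_singleton k)))
  rw [lintegral_finsetSum _ fun k _ => hm k]
  refine Finset.sum_congr rfl fun k _ => ?_
  rw [hnet.lintegral_mark y k (measurable_one.indicator hB) (measurable_one.indicator (hA k)),
    lintegral_indicator_one hB, lintegral_indicator_one (hA k), expMeasure_le_ofReal hμ,
    expMeasure_lt_ofReal hμ, expNeg_add]

/-- The probability of coverage on both bands when the positions of the base stations are fixed: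
`w n` is the path gain of base station `n` relative to that of the serving base station `y`. -/
lemma measure_coverage (hμ : 0 < μ) (hΔ : 1 ≤ Δ) (y : ℕ) {w : ℕ → ℝ} (hw : ∀ n,
    0 ≤ w n) {T T' s : ℝ}
    (hT : 0 ≤ T) (hT' : 0 ≤ T') :
    Pr {ω | ENNReal.ofReal T * (ENNReal.ofReal s + ∑' n : {n // n ≠ y}, if δ n ω = δ y ω then
          ENNReal.ofReal (gHat n ω) * ENNReal.ofReal (w n) else 0) < ENNReal.ofReal (gHat y ω) ∧
        ENNReal.ofReal T' * (ENNReal.ofReal s + ∑' n : {n // n ≠ y},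
          ENNReal.ofReal (g n ω) * ENNReal.ofReal (w n)) ≤ ENNReal.ofReal (g y ω)} =
      expNeg (ENNReal.ofReal (μ * (T + T') * s)) *
        expNeg (∑' n, if n = y then 0 else ENNReal.ofReal (markExponent Δ T T' (w n))) := by
  let A : Fin Δ → ({n // n ≠ y} → Mark Δ) → ℝ≥0∞ := fun k z =>
    ENNReal.ofReal T * (ENNReal.ofReal s + ∑' n : {n // n ≠ y}, if (z n).2.2 = k then
      ENNReal.ofReal (z n).2.1 * ENNReal.ofReal (w n) else 0)
  let B : ({n // n ≠ y} → Mark Δ) → ℝ≥0∞ := fun z =>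
    ENNReal.ofReal T' * (ENNReal.ofReal s + ∑' n : {n // n ≠ y},
      ENNReal.ofReal (z n).1 * ENNReal.ofReal (w n))
  let S : Set (Mark Δ × ({n // n ≠ y} → Mark Δ)) :=
    {p | A p.1.2.2 p.2 < ENNReal.ofReal p.1.2.1 ∧ B p.2 ≤ ENNReal.ofReal p.1.1}
  have hAm : ∀ k, Measurable (A k) := fun k => by
    refine Measurable.const_mul (Measurable.const_add (Measurable.tsum fun n => ?_) _) _
    refine Measurable.ite ?_ (by fun_prop) measurable_const
    exact (measurable_snd.comp (measurable_snd.comp (measurable_pi_apply n)))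
        (measurableSet_singleton k)
  have hBm : Measurable B :=
    Measurable.const_mul (Measurable.const_add (Measurable.tsum fun n => by fun_prop) _) _
  have hS : MeasurableSet S := by
    have hAj : Measurable fun p : Mark Δ × ({n // n ≠ y} → Mark Δ) => A p.1.2.2 p.2 :=
      (measurable_from_prod_countable_right (f := fun q : Fin Δ × ({n // n ≠ y} → Mark Δ) => A q.1
          q.2)
        hAm).comp (by fun_prop : Measurable fun p : Mark Δ × ({n // n ≠ y} → Mark Δ) => (p.1.2.2,
            p.2))
    exact (measurableSet_lt hAj (by fun_prop)).inter
      (measurableSet_le (hBm.comp measurable_snd) (by fun_prop))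
  let Y : ℕ → Ω → Mark Δ := fun n ω => (g n ω, gHat n ω, δ n ω)
  let Z : Ω → {n // n ≠ y} → Mark Δ := fun ω n => Y n ω
  have hY : ∀ n, Measurable (Y n) := fun n =>
    (hnet.measurable_g n).prodMk ((hnet.measurable_gHat n).prodMk (hnet.measurable_δ n))
  have hZ : Measurable Z := measurable_pi_iff.2 fun n => hY n
  have hind : IndepFun (Y y) Z Pr := indepFun_remaining hnet.indep_marks hY y
  -- The marks of the other stations are frozen first, so that both interferences become constants
  -- for the serving one.
  have step1 : Pr {ω | (Y y ω, Z ω) ∈ S} =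
      ∫⁻ ω, ∑ k, expNeg (ENNReal.ofReal μ * B (Z ω) + ENNReal.ofReal μ * A k (Z ω)) *
        (Δ : ℝ≥0∞)⁻¹ ∂Pr := by
    refine (measure_mem_of_indepFun hZ (hY y) hind.symm (measurable_swap hS)).trans ?_
    exact lintegral_congr fun ω => hnet.measure_fading hμ y (fun k => A k (Z ω)) (B (Z ω))
  have step2 : ∀ k, ∫⁻ ω, expNeg (ENNReal.ofReal μ * B (Z ω) + ENNReal.ofReal μ * A k (Z ω)) ∂Pr =
      expNeg (ENNReal.ofReal (μ * (T + T') * s)) *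
        expNeg (∑' n, if n = y then 0 else ENNReal.ofReal (markExponent Δ T T' (w n))) := by
    intro k
    -- With the serving sub-band fixed to `k` and the term at `y` set to 0, the exponent is a sum of
    -- independent terms over all of `ℕ`.
    let W : ℕ → Mark Δ → ℝ≥0∞ := fun n m => if n = y then 0 else
      ENNReal.ofReal (μ * (T' * w n) * m.1) +
        if m.2.2 = k then ENNReal.ofReal (μ * (T * w n) * m.2.1) else 0
    have hW : ∀ n, Measurable (W n) := fun n => by
      refine Measurable.ite (by simp) measurable_const (Measurable.add
        (g := fun m : Mark Δ => if m.2.2 = k then ENNReal.ofReal (μ * (T * w n) * m.2.1) else 0)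
            (by fun_prop)
        (Measurable.ite ?_ (by fun_prop) measurable_const))
      exact (measurable_snd.comp measurable_snd) (measurableSet_singleton k)
    have e : ∀ ω, ENNReal.ofReal μ * B (Z ω) + ENNReal.ofReal μ * A k (Z ω) =
        ENNReal.ofReal (μ * (T + T') * s) + ∑' n, W n (Y n ω) := by
      intro ω
      have e1 : ∑' n, W n (Y n ω) = ∑' n : ({n | n ≠ y} : Set ℕ),
          (ENNReal.ofReal μ * ENNReal.ofReal T' * (ENNReal.ofReal (g n ω) * ENNReal.ofReal (w n)) +
            ENNReal.ofReal μ * ENNReal.ofReal T * (if δ n ω = k then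
              ENNReal.ofReal (gHat n ω) * ENNReal.ofReal (w n) else 0)) := by
        rw [tsum_subtype {n | n ≠ y} (fun n =>
          (ENNReal.ofReal μ * ENNReal.ofReal T' * (ENNReal.ofReal (g n ω) * ENNReal.ofReal (w n)) +
            ENNReal.ofReal μ * ENNReal.ofReal T * (if δ n ω = k then
              ENNReal.ofReal (gHat n ω) * ENNReal.ofReal (w n) else 0)))]
        refine tsum_congr fun n => ?_
        by_cases hn : n = y
        · simp [W, hn]
        · rw [indicator_of_mem (by exact hn)]
          simp only [W, if_neg hn, Y]
          have hw' := hw n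
          rw [ENNReal.ofReal_mul (by positivity), ENNReal.ofReal_mul hμ.le, ENNReal.ofReal_mul hT']
          congr 1
          · ring
          · split_ifs
            · rw [ENNReal.ofReal_mul (by positivity), ENNReal.ofReal_mul hμ.le,
                ENNReal.ofReal_mul hT]
              ring
            · simp
      refine Eq.trans ?_ (congrArg (ENNReal.ofReal (μ * (T + T') * s) + ·) e1.symm)
      rw [ENNReal.tsum_add, ENNReal.tsum_mul_left, ENNReal.tsum_mul_left,
        ENNReal.ofReal_mul (by positivity), ENNReal.ofReal_mul hμ.le, ENNReal.ofReal_add hT hT']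
      have c : ∀ φ : ℕ → ℝ≥0∞, ∑' n : ({n | n ≠ y} : Set ℕ), φ n = ∑' n : {n // n ≠ y}, φ n :=
        fun _ => rfl
      rw [c fun n => ENNReal.ofReal (g n ω) * ENNReal.ofReal (w n),
        c fun n => if δ n ω = k then ENNReal.ofReal (gHat n ω) * ENNReal.ofReal (w n) else 0]
      simp only [A, B, Z, Y]
      ring
    simp_rw [e, expNeg_add]
    have hWm : Measurable fun ω => expNeg (∑' n, W n (Y n ω)) :=
      measurable_expNeg.comp (Measurable.tsum fun n => (hW n).comp (hY n))
    rw [lintegral_const_mul _ hWm]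
    congr 1
    refine lintegral_expNeg_tsum_of_iIndepFun (Y := fun n ω => W n (Y n ω))
      (hnet.indep_marks.comp W hW) (fun n => (hW n).comp (hY n)) fun n => ?_
    by_cases hn : n = y
    · simp [W, hn]
    · simp only [W, if_neg hn]
      rw [expNeg_markExponent hΔ hT hT' (hw n)]
      exact hnet.lintegral_expNeg_mark hμ hΔ n k hT hT' (hw n)
  refine step1.trans ?_
  have hm : ∀ k, Measurable fun ω => expNeg (ENNReal.ofReal μ * B (Z ω) +
      ENNReal.ofReal μ * A k (Z ω)) * (Δ : ℝ≥0∞)⁻¹ := fun k =>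
    (measurable_expNeg.comp (((hBm.comp hZ).const_mul _).add
      (((hAm k).comp hZ).const_mul _))).mul_const _
  rw [lintegral_finsetSum _ fun k _ => hm k]
  have step3 : ∀ k, ∫⁻ ω, expNeg (ENNReal.ofReal μ * B (Z ω) + ENNReal.ofReal μ * A k (Z ω)) *
        (Δ : ℝ≥0∞)⁻¹ ∂Pr = expNeg (ENNReal.ofReal (μ * (T + T') * s)) *
        expNeg (∑' n, if n = y then 0 else ENNReal.ofReal (markExponent Δ T T' (w n))) *
          (Δ : ℝ≥0∞)⁻¹ := by
    intro k
    rw [lintegral_mul_const' _ _ (by simpa using (by omega : Δ ≠ 0)), step2 k]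
  simp_rw [step3]
  -- The average over the serving sub-band is trivial, since all `Δ` terms agree.
  rw [Finset.sum_const, Finset.card_univ, Fintype.card_fin, nsmul_eq_mul, mul_left_comm,
    ENNReal.mul_inv_cancel (by simpa using (by omega : Δ ≠ 0)) (by simp), mul_one]

end IsNetwork
end

/-- Each factor is bounded below through `e⁻ᵗ ≤ 1 / (1 + t)`; the edge factor is smallest when `Δ =
1`. The bound controls both the exponent, for domination, and `1 - markTransform`, for
integrability. -/
lemma exp_neg_le_markTransform {Δ : ℕ} (hΔ : 1 ≤ Δ) {T T' w : ℝ} (hT : 0 ≤ T) (hT' : 0 ≤ T')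
    (hw : 0 ≤ w) : Real.exp (-((T + T') * w)) ≤ markTransform Δ T T' w := by
  have hΔ' : (1 : ℝ) ≤ Δ := by exact_mod_cast hΔ
  have h1 : 1 / (Δ : ℝ) ≤ 1 := by rw [div_le_one (by positivity)]; exact hΔ'
  have h3 : 1 / (1 + T * w) ≤ 1 := by
    rw [div_le_one (by positivity)]; nlinarith [mul_nonneg hT hw]
  have h4 : 1 / (Δ : ℝ) * (1 - 1 / (1 + T * w)) ≤ 1 * (1 - 1 / (1 + T * w)) :=
    mul_le_mul_of_nonneg_right h1 (by linarith)
  have hexp : ∀ t, 0 ≤ t → Real.exp (-t) ≤ 1 / (1 + t) := fun t ht => by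
    rw [Real.exp_neg, ← one_div]
    exact one_div_le_one_div_of_le (by linarith) (by linarith [Real.add_one_le_exp t])
  have e : Real.exp (-((T + T') * w)) = Real.exp (-(T' * w)) * Real.exp (-(T * w)) := by
    rw [← Real.exp_add]; congr 1; ring
  rw [e, markTransform]
  have h5 := hexp (T * w) (by positivity)
  exact mul_le_mul (hexp _ (by positivity)) (by linarith) (Real.exp_nonneg _) (by positivity)

lemma markExponent_nonneg {Δ : ℕ} (hΔ : 1 ≤ Δ) {T T' w : ℝ} (hT : 0 ≤ T) (hT' : 0 ≤ T')
    (hw : 0 ≤ w) : 0 ≤ markExponent Δ T T' w :=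
  neg_nonneg.2 (Real.log_nonpos (markTransform_pos hΔ hT hT' hw).le (markTransform_le_one hT hT'
      hw))

lemma markExponent_le {Δ : ℕ} (hΔ : 1 ≤ Δ) {T T' w : ℝ} (hT : 0 ≤ T) (hT' : 0 ≤ T')
    (hw : 0 ≤ w) : markExponent Δ T T' w ≤ (T + T') * w := by
  have := (Real.le_log_iff_exp_le (markTransform_pos hΔ hT hT' hw)).2
    (exp_neg_le_markTransform hΔ hT hT' hw)
  rw [markExponent]; linarith

lemma one_sub_markTransform_le {Δ : ℕ} (hΔ : 1 ≤ Δ) {T T' w : ℝ} (hT : 0 ≤ T) (hT' : 0 ≤ T')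
    (hw : 0 ≤ w) : 1 - markTransform Δ T T' w ≤ (T + T') * w := by
  have := exp_neg_le_markTransform hΔ hT hT' hw
  linarith [Real.add_one_le_exp (-((T + T') * w))]

@[fun_prop]
lemma measurable_markTransform (Δ : ℕ) (T T' : ℝ) : Measurable (markTransform Δ T T') := by
  unfold markTransform; fun_prop

lemma continuousOn_markExponent {Δ : ℕ} (hΔ : 1 ≤ Δ) {T T' : ℝ} (hT : 0 ≤ T) (hT' : 0 ≤ T') :
    ContinuousOn (markExponent Δ T T') (Ici 0) := by
  refine ContinuousOn.neg (ContinuousOn.log ?_ fun w hw => (markTransform_pos hΔ hT hT' hw).ne')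
  unfold markTransform
  have h1 : ∀ t, 0 ≤ t → ∀ w ∈ Ici (0 : ℝ), 1 + t * w ≠ 0 := fun t ht w hw => by
    have : 0 ≤ w := hw
    positivity
  refine ContinuousOn.mul (continuousOn_const.div (by fun_prop) (h1 T' hT')) ?_
  exact continuousOn_const.sub (continuousOn_const.mul (continuousOn_const.sub
    (continuousOn_const.div (by fun_prop) (h1 T hT))))

/-! ### The integrals `ξ` and `ρ` -/

lemma integrableOn_one_sub_markTransform {Δ : ℕ} (hΔ : 1 ≤ Δ) {T T' a : ℝ} (hT : 0 ≤ T)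
    (hT' : 0 ≤ T') (ha : 1 < a) :
    IntegrableOn (fun x : ℝ => 1 - markTransform Δ T T' (x ^ (-a))) (Ioi 1) := by
  refine Integrable.mono' ((integrableOn_Ioi_rpow_of_lt (by linarith : -a < -1)
      zero_lt_one).const_mul
    (T + T')) (Measurable.aestronglyMeasurable (by fun_prop)) ?_
  refine (ae_restrict_iff' measurableSet_Ioi).2 (ae_of_all _ fun x hx => ?_)
  have hx : 0 ≤ x ^ (-a) := Real.rpow_nonneg (zero_le_one.trans (le_of_lt hx)) _
  rw [Real.norm_of_nonneg (sub_nonneg.2 (markTransform_le_one hT hT' hx))]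
  exact one_sub_markTransform_le hΔ hT hT' hx

lemma xiIntegrand_eq (T TFR α : ℝ) (Δ : ℕ) (x : ℝ) :
    xiIntegrand T TFR α Δ x = (1 - markTransform Δ T TFR (x ^ (-α))) * x := rfl

lemma integrableOn_xiIntegrand {Δ : ℕ} (hΔ : 1 ≤ Δ) {T T' α : ℝ} (hT : 0 ≤ T)
    (hT' : 0 ≤ T') (hα : 2 < α) : IntegrableOn (xiIntegrand T T' α Δ) (Ioi 1) := by
  simp_rw [funext (xiIntegrand_eq T T' α Δ)]
  refine Integrable.mono' ((integrableOn_Ioi_rpow_of_lt (by linarith : 1 - α < -1)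
      zero_lt_one).const_mul
    (T + T')) (Measurable.aestronglyMeasurable (by fun_prop)) ?_
  refine (ae_restrict_iff' measurableSet_Ioi).2 (ae_of_all _ fun x hx => ?_)
  have hx1 : 1 < x := hx
  have hx0 : 0 < x := zero_lt_one.trans hx1
  have hx : 0 ≤ x ^ (-α) := Real.rpow_nonneg hx0.le _
  rw [Real.norm_of_nonneg (mul_nonneg (sub_nonneg.2 (markTransform_le_one hT hT' hx)) hx0.le)]
  have e : x ^ (1 - α) = x ^ (-α) * x := by
    rw [sub_eq_neg_add, Real.rpow_add hx0, Real.rpow_one]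
  rw [e, ← mul_assoc]
  exact mul_le_mul_of_nonneg_right (one_sub_markTransform_le hΔ hT hT' hx) hx0.le

/-- Substitute the squared distance for the distance: `2 x dx` becomes `dx` and the exponent `α` is
halved. -/
lemma two_mul_xi (T T' α : ℝ) (Δ : ℕ) :
    2 * xi T T' α Δ = ∫ x in Ioi 1, (1 - markTransform Δ T T' (x ^ (-(α / 2)))) := by
  have h := integral_comp_rpow_Ioi
    ((Ioi 1).indicator fun x : ℝ => 1 - markTransform Δ T T' (x ^ (-(α / 2)))) (two_ne_zero (α :=
        ℝ))
  rw [setIntegral_indicator measurableSet_Ioi, inter_eq_right.2 (Ioi_subset_Ioi zero_le_one)] at h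
  rw [← h, xi, ← integral_const_mul, ← integral_indicator measurableSet_Ioi,
    ← integral_indicator measurableSet_Ioi]
  congr 1; ext x
  by_cases hx0 : 0 < x
  · have hiff : x ^ (2 : ℝ) ∈ Ioi (1 : ℝ) ↔ x ∈ Ioi (1 : ℝ) := by
      rw [mem_Ioi, mem_Ioi, Real.rpow_two, one_lt_sq_iff₀ hx0.le]
    rw [indicator_of_mem (s := Ioi (0 : ℝ)) hx0]
    by_cases hx : x ∈ Ioi (1 : ℝ)
    · rw [indicator_of_mem hx, indicator_of_mem (hiff.2 hx), xiIntegrand_eq, ← Real.rpow_mul hx0.le]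
      have e : (2 : ℝ) * -(α / 2) = -α := by ring
      have e2 : (2 : ℝ) - 1 = 1 := by norm_num
      rw [e, e2, Real.rpow_one, abs_of_pos two_pos, smul_eq_mul]
      ring
    · rw [indicator_of_notMem hx, indicator_of_notMem (fun h => hx (hiff.1 h)), smul_zero]
  · rw [indicator_of_notMem (s := Ioi (0 : ℝ)) hx0, indicator_of_notMem]
    exact fun h => hx0 (zero_lt_one.trans h)

lemma xi_nonneg {T T' : ℝ} (hT : 0 ≤ T) (hT' : 0 ≤ T') (α : ℝ) (Δ : ℕ) : 0 ≤ xi T T' α Δ := by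
  refine setIntegral_nonneg measurableSet_Ioi fun x hx => ?_
  have hx0 : 0 < x := zero_lt_one.trans hx
  exact mul_nonneg (sub_nonneg.2 (markTransform_le_one hT hT' (Real.rpow_nonneg hx0.le _))) hx0.le

lemma lintegral_markExponent {Δ : ℕ} (hΔ : 1 ≤ Δ) {T T' α : ℝ} (hT : 0 ≤ T)
    (hT' : 0 ≤ T') (hα : 2 < α) :
    ∫⁻ x in Ioi 1, (1 - expNeg (ENNReal.ofReal (markExponent Δ T T' (x ^ (-(α / 2)))))) =
      ENNReal.ofReal (2 * xi T T' α Δ) := by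
  have hpos : ∀ x ∈ Ioi (1 : ℝ), 0 ≤ x ^ (-(α / 2)) := fun x hx =>
    Real.rpow_nonneg (zero_le_one.trans (le_of_lt hx)) _
  rw [two_mul_xi, ofReal_integral_eq_lintegral_ofReal
    (integrableOn_one_sub_markTransform hΔ hT hT' (by linarith))]
  · refine setLIntegral_congr_fun measurableSet_Ioi fun x hx => ?_
    rw [expNeg_markExponent hΔ hT hT' (hpos x hx), ENNReal.ofReal_sub _
      (markTransform_pos hΔ hT hT' (hpos x hx)).le, ENNReal.ofReal_one]
  · refine (ae_restrict_iff' measurableSet_Ioi).2 (ae_of_all _ fun x hx => ?_)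
    exact sub_nonneg.2 (markTransform_le_one hT hT' (hpos x hx))

lemma integrableOn_rhoIntegrand {α b : ℝ} (hα : 2 < α) (hb : 0 < b) :
    IntegrableOn (rhoIntegrand α) (Ioi b) := by
  refine Integrable.mono' (integrableOn_Ioi_rpow_of_lt (by linarith : -(α / 2) < -1) hb)
    (Measurable.aestronglyMeasurable (by unfold rhoIntegrand; fun_prop)) ?_
  refine (ae_restrict_iff' measurableSet_Ioi).2 (ae_of_all _ fun x hx => ?_)
  have hx0 : 0 < x := hb.trans hx
  have hp : 0 < x ^ (α / 2) := Real.rpow_pos_of_pos hx0 _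
  rw [rhoIntegrand, Real.norm_of_nonneg (by positivity), Real.rpow_neg hx0.le, ← one_div]
  exact one_div_le_one_div_of_le hp (by linarith)

/-- Substitute `u = T ^ (-2 / α) * x`, under which `u ^ (α / 2) = x ^ (α / 2) / T`. -/
lemma rho_eq {T α : ℝ} (hT : 0 < T) (hα : 2 < α) :
    rho T α = ∫ x in Ioi 1, (1 - 1 / (1 + T * x ^ (-(α / 2)))) := by
  have hb : 0 < T ^ (-2 / α) := Real.rpow_pos_of_pos hT _
  have h := integral_comp_mul_left_Ioi (rhoIntegrand α) 1 hb
  have e : T ^ (2 / α) = (T ^ (-2 / α))⁻¹ := by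
    rw [neg_div, Real.rpow_neg hT.le, inv_inv]
  rw [rho, e, ← smul_eq_mul]
  rw [mul_one] at h
  rw [← h]
  refine setIntegral_congr_fun measurableSet_Ioi fun x hx => ?_
  have hx0 : 0 < x := zero_lt_one.trans hx
  have hp : 0 < x ^ (α / 2) := Real.rpow_pos_of_pos hx0 _
  have e1 : (-2 / α) * (α / 2) = -1 := by field_simp
  simp only [rhoIntegrand]
  rw [Real.mul_rpow hb.le hx0.le, ← Real.rpow_mul hT.le, e1, Real.rpow_neg_one,
      Real.rpow_neg hx0.le]
  field_simp
  ring

lemma two_mul_xi_zero_right {T α : ℝ} (hT : 0 < T) (hα : 2 < α) (Δ : ℕ) :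
    2 * xi T 0 α Δ = 1 / (Δ : ℝ) * rho T α := by
  rw [two_mul_xi, rho_eq hT hα, ← integral_const_mul]
  congr 1; ext x
  simp [markTransform]

lemma two_mul_xi_zero_left {T α : ℝ} (hT : 0 < T) (hα : 2 < α) (Δ : ℕ) :
    2 * xi 0 T α Δ = rho T α := by
  rw [two_mul_xi, rho_eq hT hα]
  congr 1; ext x
  simp [markTransform]

lemma rho_pos {T α : ℝ} (hT : 0 < T) (hα : 2 < α) : 0 < rho T α := by
  have hb : 0 < T ^ (-2 / α) := Real.rpow_pos_of_pos hT _
  have hpos : ∀ x ∈ Ioi (T ^ (-2 / α)), 0 < rhoIntegrand α x := fun x hx => by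
    have : 0 < x ^ (α / 2) := Real.rpow_pos_of_pos (hb.trans hx) _
    rw [rhoIntegrand]; positivity
  refine mul_pos (Real.rpow_pos_of_pos hT _) ?_
  rw [setIntegral_pos_iff_support_of_nonneg_ae _ (integrableOn_rhoIntegrand hα hb)]
  · have : Ioi (T ^ (-2 / α)) ⊆ Function.support (rhoIntegrand α) := fun x hx => (hpos x hx).ne'
    rw [inter_eq_right.2 this]
    simp
  · exact (ae_restrict_iff' measurableSet_Ioi).2 (ae_of_all _ fun x hx => (hpos x hx).le)

/-! ### The integrands of the formula -/

section
variable {lam μ α P σ2 : ℝ} {Δ : ℕ}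

lemma pcIntegrand_eq_jointIntegrand {T : ℝ} (hT : 0 < T) (hα : 2 < α) :
    pcIntegrand lam μ α P σ2 Δ T = jointIntegrand lam μ α P σ2 Δ T 0 := by
  ext v
  rw [pcIntegrand, jointIntegrand, two_mul_xi_zero_right hT hα, add_zero]

/-- At edge threshold 0 the sub-bands have no effect, so `Δ` is arbitrary on the right while the
left has reuse factor 1. -/
lemma pcIntegrand_one_eq_jointIntegrand {T : ℝ} (hT : 0 < T) (hα : 2 < α) :
    pcIntegrand lam μ α P σ2 1 T = jointIntegrand lam μ α P σ2 Δ 0 T := by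
  ext v
  rw [pcIntegrand, jointIntegrand, two_mul_xi_zero_left hT hα, zero_add]
  simp

lemma jointIntegrand_nonneg (T T' v : ℝ) : 0 ≤ jointIntegrand lam μ α P σ2 Δ T T' v :=
  Real.exp_nonneg _

lemma jointIntegrand_le {T T' v : ℝ} (hμ : 0 < μ) (hP : 0 < P) (hσ : 0 ≤ σ2)
    (hT : 0 ≤ T) (hT' : 0 ≤ T') (hv : 0 < v) :
    jointIntegrand lam μ α P σ2 Δ T T' v ≤
      Real.exp (-(Real.pi * lam * (1 + 2 * xi T T' α Δ)) * v) := by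
  have : 0 ≤ μ * (T + T') * (σ2 / P) * v ^ (α / 2) := by
    have := Real.rpow_nonneg hv.le (α / 2)
    positivity
  refine Real.exp_le_exp.2 ?_
  linarith

lemma integrableOn_jointIntegrand {T T' : ℝ} (hlam : 0 < lam) (hμ : 0 < μ) (hP : 0 < P)
    (hσ : 0 ≤ σ2) (hT : 0 ≤ T) (hT' : 0 ≤ T') :
    IntegrableOn (jointIntegrand lam μ α P σ2 Δ T T') (Ioi 0) := by
  have hxi := xi_nonneg hT hT' α Δ
  refine Integrable.mono' (exp_neg_integrableOn_Ioi 0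
    (b := Real.pi * lam * (1 + 2 * xi T T' α Δ)) (by positivity))
    (by unfold jointIntegrand; fun_prop) ?_
  refine (ae_restrict_iff' measurableSet_Ioi).2 (ae_of_all _ fun v hv => ?_)
  rw [Real.norm_of_nonneg (jointIntegrand_nonneg _ _ _)]
  exact jointIntegrand_le hμ hP hσ hT hT' hv

/-- Dropping the noise can only increase the value, and leaves `1 / (1 + ρ)` with `ρ > 0`. -/
lemma pc_one_lt_one {T : ℝ} (hlam : 0 < lam) (hμ : 0 < μ) (hα : 2 < α) (hP : 0 < P) (hσ : 0 ≤ σ2)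
    (hT : 0 < T) : pc lam μ α P σ2 1 T < 1 := by
  have hρ := rho_pos hT hα
  have hκ : 0 < Real.pi * lam := by positivity
  have hr : 0 < Real.pi * lam * (1 + rho T α) := by positivity
  rw [pc, pcIntegrand_one_eq_jointIntegrand (Δ := 1) hT hα]
  calc Real.pi * lam * ∫ v in Ioi (0 : ℝ), jointIntegrand lam μ α P σ2 1 0 T v
      ≤ Real.pi * lam * ∫ v in Ioi (0 : ℝ), Real.exp (-(Real.pi * lam * (1 + rho T α)) * v) := by
        refine mul_le_mul_of_nonneg_left (setIntegral_mono_on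
          (integrableOn_jointIntegrand hlam hμ hP hσ le_rfl hT.le) (exp_neg_integrableOn_Ioi 0 hr)
          measurableSet_Ioi fun v hv => ?_) hκ.le
        rw [← two_mul_xi_zero_left hT hα 1]
        exact jointIntegrand_le hμ hP hσ le_rfl hT.le hv
    _ = 1 / (1 + rho T α) := by
        rw [integral_exp_mul_Ioi (by linarith)]
        simp only [mul_zero, Real.exp_zero]
        field_simp
    _ < 1 := by rw [div_lt_one (by positivity)]; linarith

end

/-! ### Measurability of the serving index and of the SINR -/

section Measurability

variable {Ω : Type*} [MeasurableSpace Ω] {Δ : ℕ} {X : ℕ → Ω → Plane} {h : ℕ → Ω → ℝ}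
  {δ : ℕ → Ω → Fin Δ}

lemma measurable_sInf_nat {S : Ω → Set ℕ} (hS : ∀ n, MeasurableSet {ω | n ∈ S ω}) :
    Measurable fun ω => sInf (S ω) := by
  refine measurable_of_Iic fun n => ?_
  -- The infimum of the empty set is 0, hence the first set of the union.
  have : (fun ω => sInf (S ω)) ⁻¹' Iic n = (⋂ m, {ω | m ∈ S ω}ᶜ) ∪ ⋃ m ≤ n, {ω | m ∈ S ω} := by
    ext ω
    simp only [mem_preimage, mem_Iic, mem_union, mem_iInter, mem_compl_iff, mem_ofPred_eq,
        mem_iUnion,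
      exists_prop]
    constructor
    · intro hle
      by_cases hne : (S ω).Nonempty
      · exact Or.inr ⟨_, hle, Nat.sInf_mem hne⟩
      · exact Or.inl fun m hm => hne ⟨m, hm⟩
    · rintro (hemp | ⟨m, hm, hmem⟩)
      · rw [eq_empty_iff_forall_notMem.2 hemp]; simp
      · exact (Nat.sInf_le hmem).trans hm
  rw [this]
  exact (MeasurableSet.iInter fun m => (hS m).compl).union
    (MeasurableSet.iUnion fun m => MeasurableSet.iUnion fun _ => hS m)

lemma measurable_serving (hX : ∀ n, Measurable (X n)) (u : Plane) : Measurable (serving X u) := by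
  refine measurable_sInf_nat fun n => ?_
  have : {ω | n ∈ {n : ℕ | ∀ k, dist (X n ω) u ≤ dist (X k ω) u}} =
      ⋂ k, {ω | dist (X n ω) u ≤ dist (X k ω) u} := by ext; simp
  rw [this]
  exact MeasurableSet.iInter fun k =>
    measurableSet_le ((hX n).dist measurable_const) ((hX k).dist measurable_const)

lemma measurable_apply_nat {E : Type*} [MeasurableSpace E] {N : Ω → ℕ} (hN : Measurable N)
    {F : ℕ → Ω → E} (hF : ∀ n, Measurable (F n)) : Measurable fun ω => F (N ω) ω :=
  (measurable_from_prod_countable_right (f := fun q : ℕ × Ω => F q.1 q.2) hF).comp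
    (hN.prodMk measurable_id)

lemma measurable_gain (hX : ∀ n, Measurable (X n)) (hh : ∀ n, Measurable (h n)) (u : Plane) (α : ℝ)
    (n : ℕ) : Measurable fun ω => gain X h u α ω n :=
  (hh n).mul (((hX n).dist measurable_const).pow_const (-α))

lemma measurable_sinr (hX : ∀ n, Measurable (X n)) (hh : ∀ n, Measurable (h n)) {Z : Ω → Set ℕ}
    (hZ : ∀ n, MeasurableSet {ω | n ∈ Z ω}) (u : Plane) (α P σ2 : ℝ) :
    Measurable (sinr X h Z u α P σ2) := by
  refine Measurable.div (Measurable.const_mul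
    (measurable_apply_nat (F := fun n ω => gain X h u α ω n) (measurable_serving hX u)
      (measurable_gain hX hh u α)) _) (Measurable.const_add (Measurable.const_mul ?_ _) _)
  have : (fun ω => ∑' z : Z ω, gain X h u α ω z) =
      fun ω => ∑' n, {ω | n ∈ Z ω}.indicator (fun ω => gain X h u α ω n) ω := by
    ext ω
    rw [tsum_subtype (Z ω) (gain X h u α ω)]
    rfl
  rw [this]
  exact Measurable.tsum fun n => (measurable_gain hX hh u α n).indicator (hZ n)

lemma measurableSet_mem_commonInterferers (hX : ∀ n, Measurable (X n)) (u : Plane) (n : ℕ) :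
    MeasurableSet {ω | n ∈ commonInterferers X u ω} :=
  (measurableSet_eq_fun measurable_const (measurable_serving hX u)).compl

lemma measurableSet_mem_edgeInterferers (hX : ∀ n, Measurable (X n)) (hδ : ∀ n, Measurable (δ n))
    (u : Plane) (n : ℕ) : MeasurableSet {ω | n ∈ edgeInterferers X δ u ω} :=
  (measurableSet_mem_commonInterferers hX u n).inter
    (measurableSet_eq_fun (hδ n) (measurable_apply_nat (measurable_serving hX u) hδ))

end Measurability

/-! ### The SINR of a fixed configuration -/

section Deterministic

variable {Ω : Type*} {X : ℕ → Ω → Plane} {h : ℕ → Ω → ℝ} {Z : Ω → Set ℕ}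
  {u : Plane} {α P σ2 T : ℝ} {ω : Ω}

lemma serving_eq {y : ℕ} (hy : ∀ n ≠ y, dist (X y ω) u < dist (X n ω) u) : serving X u ω = y := by
  have : {n : ℕ | ∀ k, dist (X n ω) u ≤ dist (X k ω) u} = {y} := by
    ext n
    refine ⟨fun hn => ?_, ?_⟩
    · by_contra hne
      exact absurd (hn y) (not_le.2 (hy n hne))
    · rintro rfl k
      rcases eq_or_ne k n with rfl | hk
      · exact le_rfl
      · exact (hy k hk).le
  rw [serving, this, csInf_singleton]

/-- Comparison of the SINR with a threshold, in terms of relative path gains. -/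
lemma sinr_threshold (hP : 0 < P) (hσ : 0 ≤ σ2) (hT : 0 ≤ T)
    (hd : ∀ n, 0 < dist (X n ω) u) (hh : ∀ n, 0 < h n ω)
    (hs : Summable fun n => gain X h u α ω n) (hZ : (Z ω).Nonempty) :
    (T < sinr X h Z u α P σ2 ω ↔
      ENNReal.ofReal T * (ENNReal.ofReal (σ2 / P * dist (X (serving X u ω) ω) u ^ α) +
        ∑' n : Z ω, ENNReal.ofReal (h n ω) *
          ENNReal.ofReal ((dist (X n ω) u / dist (X (serving X u ω) ω) u) ^ (-α))) <
        ENNReal.ofReal (h (serving X u ω) ω)) ∧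
    (T ≤ sinr X h Z u α P σ2 ω ↔
      ENNReal.ofReal T * (ENNReal.ofReal (σ2 / P * dist (X (serving X u ω) ω) u ^ α) +
        ∑' n : Z ω, ENNReal.ofReal (h n ω) *
          ENNReal.ofReal ((dist (X n ω) u / dist (X (serving X u ω) ω) u) ^ (-α))) ≤
        ENNReal.ofReal (h (serving X u ω) ω)) := by
  set y := serving X u ω with hydef
  set d : ℕ → ℝ := fun n => dist (X n ω) u with hddef
  have hgain : ∀ n, gain X h u α ω n = h n ω * d n ^ (-α) := fun n => rfl
  have hgpos : ∀ n, 0 < gain X h u α ω n := fun n =>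
    mul_pos (hh n) (Real.rpow_pos_of_pos (hd n) _)
  set I : ℝ := ∑' n : Z ω, gain X h u α ω n with hI
  have hsZ : Summable fun n : Z ω => gain X h u α ω n := hs.subtype _
  -- Positive interference keeps the denominator positive when `σ2 = 0`; this is where nonemptiness
  -- of the interferer set enters.
  have hIpos : 0 < I := by
    obtain ⟨n, hn⟩ := hZ
    exact hsZ.tsum_pos (fun n => (hgpos n).le) ⟨n, hn⟩ (hgpos n)
  have hr : 0 < d y ^ α := Real.rpow_pos_of_pos (hd y) _
  have e1 : ∑' n : Z ω, ENNReal.ofReal (h n ω) * ENNReal.ofReal ((d n / d y) ^ (-α)) =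
      ENNReal.ofReal (d y ^ α * I) := by
    rw [hI, ← tsum_mul_left, ENNReal.ofReal_tsum_of_nonneg
      (f := fun n : Z ω => d y ^ α * gain X h u α ω n)
      (fun n => mul_nonneg hr.le (hgpos n).le) (hsZ.mul_left _)]
    refine tsum_congr fun n => ?_
    rw [← ENNReal.ofReal_mul (hh n).le, hgain, Real.div_rpow (hd n).le (hd y).le,
      Real.rpow_neg (hd y).le, div_inv_eq_mul]
    congr 1; ring
  have hD : 0 < σ2 + P * I := by positivity
  have e2 : ENNReal.ofReal T * (ENNReal.ofReal (σ2 / P * d y ^ α) +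
      ∑' n : Z ω, ENNReal.ofReal (h n ω) * ENNReal.ofReal ((d n / d y) ^ (-α))) =
      ENNReal.ofReal (T * (σ2 + P * I) * (d y ^ α / P)) := by
    rw [e1, ← ENNReal.ofReal_add (by positivity) (by positivity), ← ENNReal.ofReal_mul hT]
    congr 1; field_simp
  have e3 : h y ω = P * gain X h u α ω y * (d y ^ α / P) := by
    rw [hgain, Real.rpow_neg (show 0 ≤ d y from (hd y).le)]
    field_simp
  have hc : 0 < d y ^ α / P := by positivity
  have e4 : sinr X h Z u α P σ2 ω = P * gain X h u α ω y / (σ2 + P * I) := rfl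
  rw [e2, e4]
  constructor
  · rw [ENNReal.ofReal_lt_ofReal_iff (hh y), e3, mul_lt_mul_iff_left₀ hc, lt_div_iff₀ hD]
  · rw [ENNReal.ofReal_le_ofReal_iff (hh y).le, e3, mul_le_mul_iff_left₀ hc, le_div_iff₀ hD]

end Deterministic

/-! ### Almost sure properties of the network -/

section
variable {Ω : Type*} [MeasurableSpace Ω] {Pr : Measure Ω} [IsProbabilityMeasure Pr]
  {lam μ α : ℝ} {Δ : ℕ} {X : ℕ → Ω → Plane} {g gHat : ℕ → Ω → ℝ} {δ : ℕ → Ω → Fin Δ}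

namespace IsNetwork
variable (hnet : IsNetwork Pr lam μ Δ X g gHat δ)
include hnet

omit [IsProbabilityMeasure Pr] in
lemma isPoissonProcess_dist_sq (u : Plane) :
    IsPoissonProcess Pr (fun n ω => dist (X n ω) u ^ 2) (halfLine (Real.pi * lam)) := by
  rw [← map_dist_sq_volume lam u]
  exact hnet.poisson.map (φ := fun x => dist x u ^ 2) (by fun_prop)

lemma ae_positions (hα : 2 < α) (u : Plane) : ∀ᵐ ω ∂Pr,
    (∀ n, 0 < dist (X n ω) u) ∧ (Summable fun n => dist (X n ω) u ^ (-α)) ∧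
      ∀ n ≠ serving X u ω, dist (X (serving X u ω) ω) u < dist (X n ω) u := by
  have hV := hnet.isPoissonProcess_dist_sq u
  filter_upwards [hV.ae_summable_rpow (a := α / 2) (by linarith),
    hV.ae_injective fun n ω => sq_nonneg _] with ω ⟨hpos, hsum⟩ hinj
  have hd : ∀ n, 0 < dist (X n ω) u := fun n =>
    lt_of_pow_lt_pow_left₀ 2 dist_nonneg (by simpa using hpos n)
  obtain ⟨y, hy⟩ := exists_forall_ne_lt (by linarith) hpos hsum hinj
  have hy' : ∀ n ≠ y, dist (X y ω) u < dist (X n ω) u := fun n hn =>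
    lt_of_pow_lt_pow_left₀ 2 (hd n).le (hy n hn)
  refine ⟨hd, hsum.congr fun n => ?_, ?_⟩
  · rw [← Real.rpow_two, ← Real.rpow_mul (hd n).le]
    congr 1; ring
  · rw [serving_eq hy']; exact hy'

omit [IsProbabilityMeasure Pr] in
lemma measurable_positions : Measurable fun ω n => X n ω :=
  measurable_pi_iff.2 hnet.poisson.measurable

omit [IsProbabilityMeasure Pr] in
lemma measurable_marks : Measurable fun ω n => (g n ω, gHat n ω, δ n ω) :=
  measurable_pi_iff.2 fun n =>
    (hnet.measurable_g n).prodMk ((hnet.measurable_gHat n).prodMk (hnet.measurable_δ n))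

/-- With positions frozen outside a null set, the path gains are summable and the first moment bound
applies; independence of positions and marks then allows both to vary. -/
lemma ae_summable_gain (hμ : 0 < μ) (hα : 2 < α) (u : Plane) :
    ∀ᵐ ω ∂Pr, (Summable fun n => gain X g u α ω n) ∧ Summable fun n => gain X gHat u α ω n := by
  have key : ∀ φ : Mark Δ → ℝ, Measurable φ →
      (∀ n, Pr.map (fun ω => φ (g n ω, gHat n ω, δ n ω)) = expMeasure μ) →
      ∀ᵐ ω ∂Pr, Summable fun n => φ (g n ω, gHat n ω, δ n ω) * dist (X n ω) u ^ (-α) := by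
    intro φ hφ hlaw
    have hm : ∀ n, Measurable fun ω => φ (g n ω, gHat n ω, δ n ω) := fun n =>
      hφ.comp ((measurable_pi_apply n).comp hnet.measurable_marks)
    let S : Set ((ℕ → Plane) × (ℕ → Mark Δ)) := {p | ∑' n, ENNReal.ofReal (φ (p.2 n)) *
      ENNReal.ofReal (dist (p.1 n) u ^ (-α)) ≠ ⊤}
    have hS : MeasurableSet S := by
      have : Measurable fun p : (ℕ → Plane) × (ℕ → Mark Δ) => ∑' n, ENNReal.ofReal (φ (p.2 n)) *
          ENNReal.ofReal (dist (p.1 n) u ^ (-α)) := Measurable.tsum fun n => by fun_prop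
      exact this (measurableSet_singleton ⊤).compl
    have hae := ae_mem_of_indepFun hnet.measurable_positions hnet.measurable_marks
      hnet.indep_position hS (by
        filter_upwards [hnet.ae_positions hα u] with ω ⟨hd, hsum, _⟩
        exact ae_summable_mul_of_exponential hm hμ hlaw (fun n => Real.rpow_nonneg (hd n).le _)
            hsum)
    filter_upwards [hae, ae_forall_pos_of_exponential hm hμ hlaw, hnet.ae_positions hα u]
      with ω hω hpos ⟨hd, _, _⟩
    have hfin : ∑' n, ENNReal.ofReal (φ (g n ω, gHat n ω, δ n ω)) *
      ENNReal.ofReal (dist (X n ω) u ^ (-α)) ≠ ⊤ := hω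
    refine (ENNReal.summable_toReal hfin).congr fun n => ?_
    rw [ENNReal.toReal_mul, ENNReal.toReal_ofReal (hpos n).le,
      ENNReal.toReal_ofReal (Real.rpow_nonneg (hd n).le _)]
  filter_upwards [key (fun m => m.1) measurable_fst hnet.law_g,
    key (fun m => m.2.1) (measurable_fst.comp measurable_snd) hnet.law_gHat] with ω h1 h2
  exact ⟨h1, h2⟩

end IsNetwork
end

/-! ### The joint coverage probability -/

section
variable {Ω : Type*} [MeasurableSpace Ω] {Pr : Measure Ω} [IsProbabilityMeasure Pr]
  {lam μ α P σ2 T T' : ℝ} {Δ : ℕ} {X : ℕ → Ω → Plane} {g gHat : ℕ → Ω → ℝ} {δ : ℕ → Ω → Fin Δ}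

namespace IsNetwork
variable (hnet : IsNetwork Pr lam μ Δ X g gHat δ)
include hnet

/-- The probability of joint coverage when the base stations are at the fixed positions `x`. -/
lemma measure_coverage_of_positions (hμ : 0 < μ) (hP : 0 < P) (hσ : 0 ≤ σ2)
    (hΔ : 1 ≤ Δ) (hT : 0 ≤ T) (hT' : 0 ≤ T') (u : Plane) {x : ℕ → Plane}
    (hd : ∀ n, 0 < dist (x n) u) (hsum : Summable fun n => dist (x n) u ^ (-α)) {y : ℕ}
    (hy : ∀ n ≠ y, dist (x y) u < dist (x n) u) :
    Pr {ω | T < sinr (fun n _ => x n) gHat (edgeInterferers (fun n _ => x n) δ u) u α P σ2 ω ∧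
        T' ≤ sinr (fun n _ => x n) g (commonInterferers (fun n _ => x n) u) u α P σ2 ω} =
      expNeg (ENNReal.ofReal (μ * (T + T') * (σ2 / P * dist (x y) u ^ α))) *
        expNeg (∑' n, if n = y then 0 else ENNReal.ofReal
          (markExponent Δ T T' ((dist (x n) u / dist (x y) u) ^ (-α)))) := by
  have hserv : ∀ ω : Ω, serving (fun n (_ : Ω) => x n) u ω = y := fun ω => serving_eq hy
  rw [← hnet.measure_coverage hμ hΔ y (fun n => Real.rpow_nonneg (div_nonneg (hd n).le (hd y).le) _)
    hT hT']
  refine measure_congr ?_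
  have hw0 : ∀ n, 0 ≤ dist (x n) u ^ (-α) := fun n => Real.rpow_nonneg (hd n).le _
  filter_upwards [ae_forall_pos_of_exponential hnet.measurable_g hμ hnet.law_g,
    ae_forall_pos_of_exponential hnet.measurable_gHat hμ hnet.law_gHat,
    ae_summable_mul_of_exponential hnet.measurable_g hμ hnet.law_g hw0 hsum,
    ae_summable_mul_of_exponential hnet.measurable_gHat hμ hnet.law_gHat hw0 hsum,
    hnet.ae_exists_band] with ω hg hh hsg hsh hband
  have hsg' : Summable fun n => gain (fun n (_ : Ω) => x n) g u α ω n :=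
    (ENNReal.summable_toReal hsg).congr fun n => by
      rw [ENNReal.toReal_mul, ENNReal.toReal_ofReal (hg n).le, ENNReal.toReal_ofReal (hw0 n)]; rfl
  have hsh' : Summable fun n => gain (fun n (_ : Ω) => x n) gHat u α ω n :=
    (ENNReal.summable_toReal hsh).congr fun n => by
      rw [ENNReal.toReal_mul, ENNReal.toReal_ofReal (hh n).le, ENNReal.toReal_ofReal (hw0 n)]; rfl
  -- One station other than `y` on its sub-band makes both interferer sets nonempty.
  obtain ⟨n, hn, hnb⟩ := hband y (δ y ω)
  have h1 := (sinr_threshold (X := fun n (_ : Ω) => x n) (T := T) hP hσ hT hd hh hsh'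
    (Z := edgeInterferers (fun n (_ : Ω) => x n) δ u)
    ⟨n, by rw [hserv]; exact hn, by rw [hserv]; exact hnb⟩).1
  have h2 := (sinr_threshold (X := fun n (_ : Ω) => x n) (T := T') hP hσ hT' hd hg hsg'
    (Z := commonInterferers (fun n (_ : Ω) => x n) u)
    ⟨n, by rw [commonInterferers, hserv]; exact hn⟩).2
  refine propext (and_congr (h1.trans ?_) (h2.trans ?_))
  · simp only [hserv]
    have e : ∀ φ : ℕ → ℝ≥0∞, ∑' n : edgeInterferers (fun n (_ : Ω) => x n) δ u ω, φ n =
        ∑' n : {n // n ≠ y}, if δ n ω = δ y ω then φ n else 0 := by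
      intro φ
      refine (tsum_subtype _ φ).trans (Eq.trans ?_ (tsum_subtype {n | n ≠ y}
        fun n => if δ n ω = δ y ω then φ n else 0).symm)
      refine tsum_congr fun n => ?_
      simp only [indicator, edgeInterferers, hserv, mem_ofPred_eq, ite_and]
    rw [e fun n => ENNReal.ofReal (gHat n ω) *
      ENNReal.ofReal ((dist (x n) u / dist (x y) u) ^ (-α))]
  · simp only [hserv]
    have e : ∀ φ : ℕ → ℝ≥0∞, ∑' n : commonInterferers (fun n (_ : Ω) => x n) u ω, φ n =
        ∑' n : {n // n ≠ y}, φ n := by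
      intro φ
      have : commonInterferers (fun n (_ : Ω) => x n) u ω = {n | n ≠ y} := by
        rw [commonInterferers, hserv]
      rw [this]; rfl
    rw [e fun n => ENNReal.ofReal (g n ω) *
      ENNReal.ofReal ((dist (x n) u / dist (x y) u) ^ (-α))]

/-- The probability that the user is covered on both bands, with different thresholds. -/
lemma measure_joint_coverage (hlam : 0 < lam) (hμ : 0 < μ) (hα : 2 < α) (hP : 0 < P) (hσ : 0 ≤ σ2)
    (hΔ : 1 ≤ Δ) (hT : 0 ≤ T) (hT' : 0 ≤ T') (u : Plane) :
    Pr {ω | T < sinr X gHat (edgeInterferers X δ u) u α P σ2 ω ∧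
        T' ≤ sinr X g (commonInterferers X u) u α P σ2 ω} =
      ENNReal.ofReal (Real.pi * lam *
        ∫ v in Ioi (0 : ℝ), jointIntegrand lam μ α P σ2 Δ T T' v) := by
  have hκ : 0 < Real.pi * lam := by positivity
  -- The network is rebuilt on the space of pairs (positions, marks), so that coverage is a
  -- measurable set there and Fubini can freeze the positions.
  let X' : ℕ → (ℕ → Plane) × (ℕ → Mark Δ) → Plane := fun n p => p.1 n
  let g' : ℕ → (ℕ → Plane) × (ℕ → Mark Δ) → ℝ := fun n p => (p.2 n).1
  let gHat' : ℕ → (ℕ → Plane) × (ℕ → Mark Δ) → ℝ := fun n p => (p.2 n).2.1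
  let δ' : ℕ → (ℕ → Plane) × (ℕ → Mark Δ) → Fin Δ := fun n p => (p.2 n).2.2
  let S : Set ((ℕ → Plane) × (ℕ → Mark Δ)) :=
    {p | T < sinr X' gHat' (edgeInterferers X' δ' u) u α P σ2 p ∧
      T' ≤ sinr X' g' (commonInterferers X' u) u α P σ2 p}
  have hX' : ∀ n, Measurable (X' n) := fun n => by fun_prop
  have hδ' : ∀ n, Measurable (δ' n) := fun n => by fun_prop
  have hS : MeasurableSet S :=
    (measurableSet_lt measurable_const (measurable_sinr hX' (fun n => by fun_prop)
      (measurableSet_mem_edgeInterferers hX' hδ' u) u α P σ2)).inter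
    (measurableSet_le measurable_const (measurable_sinr hX' (fun n => by fun_prop)
      (measurableSet_mem_commonInterferers hX' u) u α P σ2))
  have step1 := measure_mem_of_indepFun hnet.measurable_positions hnet.measurable_marks
    hnet.indep_position hS
  refine step1.trans ?_
  let V : ℕ → Ω → ℝ := fun n ω => dist (X n ω) u ^ 2
  let v : Ω → ℝ := fun ω => V (serving X u ω) ω
  have hV : IsPoissonProcess Pr V (halfLine (Real.pi * lam)) := hnet.isPoissonProcess_dist_sq u
  have hvm : Measurable v :=
    measurable_apply_nat (measurable_serving hnet.poisson.measurable u) hV.measurable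
  have hv : ∀ᵐ ω ∂Pr, ∃ y, v ω = V y ω ∧ ∀ n ≠ y, v ω < V n ω := by
    filter_upwards [hnet.ae_positions hα u] with ω ⟨_, _, hy⟩
    exact ⟨_, rfl, fun n hn => pow_lt_pow_left₀ (hy n hn) dist_nonneg two_ne_zero⟩
  let f : ℝ → ℝ := fun x => markExponent Δ T T' (x ^ (-(α / 2)))
  have hf : Measurable f := by
    have : Measurable (markExponent Δ T T') :=
      ((Real.measurable_log.comp (measurable_markTransform Δ T T'))).neg
    exact this.comp (by fun_prop)
  have hpow : ∀ x : ℝ, 1 ≤ x → 0 ≤ x ^ (-(α / 2)) := fun x hx => Real.rpow_nonneg (by linarith) _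
  have hfc : ContinuousOn f (Ioi 1) := by
    refine (continuousOn_markExponent hΔ hT hT').comp ?_ fun x hx => hpow x (le_of_lt hx)
    exact continuousOn_id.rpow_const fun x hx => Or.inl (zero_lt_one.trans hx).ne'
  let H : ℝ → ℝ≥0∞ := fun x => expNeg (ENNReal.ofReal (μ * (T + T') * (σ2 / P * x ^ (α / 2))))
  have hH : Continuous H := by
    refine continuous_expNeg.comp (ENNReal.continuous_ofReal.comp ?_)
    exact continuous_const.mul (continuous_const.mul (Real.continuous_rpow_const (by linarith)))
  have main := hV.lintegral_expNeg_min hκ (by linarith : 1 < α / 2) hvm (fun ω => sq_nonneg _) hv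
      hf hfc
    (fun x hx => markExponent_nonneg hΔ hT hT' (hpow x hx)) (add_nonneg hT hT')
    (fun x hx => markExponent_le hΔ hT hT' (hpow x hx)) (lintegral_markExponent hΔ hT hT' hα)
    hH (fun x => expNeg_le_one _)
  -- The condition `v ω < V n ω` selects exactly the stations other than the serving one, because
  -- the minimum is almost surely strict.
  have step2 : ∫⁻ ω, Pr {ω' | ((fun n => X n ω), fun n => (g n ω', gHat n ω', δ n ω')) ∈ S} ∂Pr =
      ∫⁻ ω, H (v ω) *
        expNeg (∑' n, if v ω < V n ω then ENNReal.ofReal (f (V n ω / v ω)) else 0) ∂Pr := by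
    refine lintegral_congr_ae ?_
    filter_upwards [hnet.ae_positions hα u] with ω ⟨hd, hsum, hy⟩
    refine (hnet.measure_coverage_of_positions hμ hP hσ hΔ hT hT' u hd hsum hy).trans ?_
    have hsq : ∀ t : ℝ, 0 ≤ t → ∀ β : ℝ, (t ^ 2) ^ (β / 2) = t ^ β := fun t ht β => by
      rw [← Real.rpow_two, ← Real.rpow_mul ht]; congr 1; ring
    simp only [H, v, V]
    rw [hsq _ dist_nonneg]
    congr 3
    ext n
    by_cases hn : n = serving X u ω
    · subst hn; simp
    · rw [if_neg hn, if_pos (pow_lt_pow_left₀ (hy n hn) dist_nonneg two_ne_zero)]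
      simp only [f]
      rw [← div_pow, ← neg_div, hsq _ (div_nonneg dist_nonneg dist_nonneg)]
  refine step2.trans (main.trans ?_)
  have hxi := xi_nonneg hT hT' α Δ
  rw [← integral_const_mul, ofReal_integral_eq_lintegral_ofReal
    ((integrableOn_jointIntegrand hlam hμ hP hσ hT hT').const_mul _)
    (ae_of_all _ fun x => mul_nonneg hκ.le (Real.exp_nonneg _))]
  refine setLIntegral_congr_fun measurableSet_Ioi fun x hx => ?_
  have hx : 0 < x := hx
  have hxa : 0 ≤ x ^ (α / 2) := Real.rpow_nonneg hx.le _
  simp only [H]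
  rw [← ENNReal.ofReal_mul hκ.le, ← ENNReal.ofReal_mul (by positivity),
      expNeg_ofReal (by positivity),
    expNeg_ofReal (by positivity), ← ENNReal.ofReal_mul (by positivity),
    ← ENNReal.ofReal_mul (by positivity), jointIntegrand, mul_assoc (Real.pi * lam), ← Real.exp_add,
    ← Real.exp_add]
  congr 3
  ring

end IsNetwork
end

end StrictFFR

/-- Coverage probability of an edge user under Strict FFR. The last conjunct is the formula; the
others say that the interference series converge almost surely, that the user is an edge user with
positive probability, and that the integrals in the formula converge. -/
theorem theorem1 {Ω : Type*} [MeasurableSpace Ω] (Pr : Measure Ω) [IsProbabilityMeasure Pr]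
    (lam μ α P σ2 T TFR : ℝ) (Δ : ℕ)
    (hlam : 0 < lam) (hμ : 0 < μ) (hα : 2 < α) (hP : 0 < P) (hσ : 0 ≤ σ2)
    (hT : 0 < T) (hTFR : 0 < TFR) (hΔ : 1 ≤ Δ)
    (X : ℕ → Ω → StrictFFR.Plane) (g gHat : ℕ → Ω → ℝ) (δ : ℕ → Ω → Fin Δ)
    (hnet : StrictFFR.IsNetwork Pr lam μ Δ X g gHat δ) (u : StrictFFR.Plane) :
    (∀ᵐ ω ∂Pr,
      Summable (fun z : StrictFFR.commonInterferers X u ω => StrictFFR.gain X g u α ω z) ∧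
      Summable (fun z : StrictFFR.edgeInterferers X δ u ω => StrictFFR.gain X gHat u α ω z)) ∧
    0 < Pr {ω | StrictFFR.sinr X g (StrictFFR.commonInterferers X u) u α P σ2 ω < TFR} ∧
    IntegrableOn (StrictFFR.rhoIntegrand α) (Ioi (T ^ (-2 / α))) ∧
    IntegrableOn (StrictFFR.rhoIntegrand α) (Ioi (TFR ^ (-2 / α))) ∧
    IntegrableOn (StrictFFR.xiIntegrand T TFR α Δ) (Ioi 1) ∧
    IntegrableOn (StrictFFR.pcIntegrand lam μ α P σ2 Δ T) (Ioi 0) ∧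
    IntegrableOn (StrictFFR.pcIntegrand lam μ α P σ2 1 TFR) (Ioi 0) ∧
    IntegrableOn (StrictFFR.jointIntegrand lam μ α P σ2 Δ T TFR) (Ioi 0) ∧
    StrictFFR.pc lam μ α P σ2 1 TFR < 1 ∧
    (cond Pr {ω | StrictFFR.sinr X g (StrictFFR.commonInterferers X u) u α P σ2 ω < TFR}).real
        {ω | T < StrictFFR.sinr X gHat (StrictFFR.edgeInterferers X δ u) u α P σ2 ω} =
      (StrictFFR.pc lam μ α P σ2 Δ T -
          Real.pi * lam *
            ∫ v in Ioi (0 : ℝ), StrictFFR.jointIntegrand lam μ α P σ2 Δ T TFR v) /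
        (1 - StrictFFR.pc lam μ α P σ2 1 TFR) := by
  open StrictFFR in
  have hκ : 0 < Real.pi * lam := by positivity
  have hX := hnet.poisson.measurable
  set A := {ω | sinr X g (commonInterferers X u) u α P σ2 ω < TFR} with hA
  set B := {ω | T < sinr X gHat (edgeInterferers X δ u) u α P σ2 ω} with hB
  have hmg := measurable_sinr hX hnet.measurable_g
    (measurableSet_mem_commonInterferers hX u) u α P σ2
  have hmh := measurable_sinr hX hnet.measurable_gHat
    (measurableSet_mem_edgeInterferers hX hnet.measurable_δ u) u α P σ2
  have hAm : MeasurableSet A := measurableSet_lt hmg measurable_const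
  have hBm : MeasurableSet B := measurableSet_lt measurable_const hmh
  have hint : ∀ {t t' : ℝ}, 0 ≤ t → 0 ≤ t' →
      IntegrableOn (jointIntegrand lam μ α P σ2 Δ t t') (Ioi 0) := fun ht ht' =>
    integrableOn_jointIntegrand hlam hμ hP hσ ht ht'
  have joint : ∀ {t t' : ℝ}, 0 ≤ t → 0 ≤ t' →
      Pr.real {ω | t < sinr X gHat (edgeInterferers X δ u) u α P σ2 ω ∧
        t' ≤ sinr X g (commonInterferers X u) u α P σ2 ω} =
      Real.pi * lam * ∫ v in Ioi (0 : ℝ), jointIntegrand lam μ α P σ2 Δ t t' v := by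
    intro t t' ht ht'
    rw [measureReal_def, hnet.measure_joint_coverage hlam hμ hα hP hσ hΔ ht ht',
      ENNReal.toReal_ofReal (mul_nonneg hκ.le (setIntegral_nonneg measurableSet_Ioi
        fun v _ => jointIntegrand_nonneg _ _ _))]
  -- At thresholds `(0, 0)` the joint formula integrates an exponential density and gives 1, so a
  -- zero threshold can be added or removed almost surely.
  have hpos : ∀ᵐ ω ∂Pr, 0 < sinr X gHat (edgeInterferers X δ u) u α P σ2 ω ∧
      0 ≤ sinr X g (commonInterferers X u) u α P σ2 ω := by
    have h := joint le_rfl le_rfl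
    have h1 : ∀ v, jointIntegrand lam μ α P σ2 Δ 0 0 v = Real.exp (-(Real.pi * lam) * v) := by
      intro v
      have : xi 0 0 α Δ = 0 := by simp [xi, xiIntegrand]
      rw [jointIntegrand, this]; congr 1; ring
    simp_rw [h1] at h
    rw [integral_exp_mul_Ioi (by linarith), mul_zero, Real.exp_zero,
      (by field_simp : Real.pi * lam * (-1 / -(Real.pi * lam)) = 1)] at h
    have hms : MeasurableSet {ω | 0 < sinr X gHat (edgeInterferers X δ u) u α P σ2 ω ∧
        0 ≤ sinr X g (commonInterferers X u) u α P σ2 ω} :=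
      (measurableSet_lt measurable_const hmh).inter (measurableSet_le measurable_const hmg)
    refine (prob_compl_eq_zero_iff hms).2 ?_
    rw [← ofReal_measureReal, h, ENNReal.ofReal_one]
  have hAc : Pr.real Aᶜ = pc lam μ α P σ2 1 TFR := by
    rw [pc, pcIntegrand_one_eq_jointIntegrand (Δ := Δ) hTFR hα, ← joint le_rfl hTFR.le]
    refine measureReal_congr ?_
    filter_upwards [hpos] with ω hω
    exact propext ⟨fun h => ⟨hω.1, not_lt.1 h⟩, fun h => not_lt.2 h.2⟩
  have hBp : Pr.real B = pc lam μ α P σ2 Δ T := by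
    rw [pc, pcIntegrand_eq_jointIntegrand hT hα, ← joint hT.le le_rfl]
    refine measureReal_congr ?_
    filter_upwards [hpos] with ω hω
    exact propext ⟨fun h => ⟨h, hω.2⟩, fun h => h.1⟩
  have hBA : Pr.real (B \ A) =
      Real.pi * lam * ∫ v in Ioi (0 : ℝ), jointIntegrand lam μ α P σ2 Δ T TFR v := by
    rw [← joint hT.le hTFR.le]
    congr 1; ext ω
    exact and_congr_right fun _ => (not_lt (a := sinr X g (commonInterferers X u) u α P σ2 ω))
  have hpc := pc_one_lt_one hlam hμ hα hP hσ hTFR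
  have hAr : Pr.real A = 1 - pc lam μ α P σ2 1 TFR := by
    rw [← hAc, probReal_compl_eq_one_sub hAm]; ring
  refine ⟨?_, ?_, integrableOn_rhoIntegrand hα (Real.rpow_pos_of_pos hT _),
    integrableOn_rhoIntegrand hα (Real.rpow_pos_of_pos hTFR _),
    integrableOn_xiIntegrand hΔ hT.le hTFR.le hα, ?_, ?_, hint hT.le hTFR.le, hpc, ?_⟩
  · filter_upwards [hnet.ae_summable_gain hμ hα u] with ω ⟨h1, h2⟩
    exact ⟨h1.subtype _, h2.subtype _⟩
  · rw [← ofReal_measureReal, hAr]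
    exact ENNReal.ofReal_pos.2 (by linarith)
  · rw [pcIntegrand_eq_jointIntegrand hT hα]; exact hint hT.le le_rfl
  · rw [pcIntegrand_one_eq_jointIntegrand (Δ := Δ) hTFR hα]; exact hint le_rfl hTFR.le
  -- The numerator is `P(B ∩ A) = P(B) - P(B \ A)`.
  · rw [measureReal_def, cond_apply hAm, ENNReal.toReal_mul, ENNReal.toReal_inv, ← measureReal_def,
      ← measureReal_def, hAr, ← hBp, ← hBA, ← measureReal_inter_add_sdiff (s := B) hAm,
          add_sub_cancel_right,
      inter_comm, inv_mul_eq_div]
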